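/- Let $d\ge 2$, let $S:\mathbb R^d\to\mathbb R$ be twice continuously differentiable, and let $\mathcal M=\mathbb R^d\times S^{d-1}$, where $S^{d-1}\subset\mathbb R^d$ is the unit sphere. Put $f(x)=-\nabla S(x)/(d-1)$ and $P(u)=I-uu^T$. Let $\varphi_t:\mathcal M\to\mathcal M$, $t\in\mathbb R$, be the flow of $$\dot x=u,\qquad \dot u=P(u)f(x).$$ For $\eta\in\mathbb R$ let $(K^\eta_t)_{t\ge0}$ be the transition semigroup of Brownian motion on the sphere with noise strength $\eta$ (the Stratonovich equation $du=\eta P(u)\circ dW$), i.e. the semigroup of Markov kernels on $S^{d-1}$ whose infinitesimal generator (for uniform convergence) is $\frac{\eta^2}{2}\widehat\nabla^2$ on smooth functions, where $\widehat\nabla^2$ is the Laplace–Beltrami operator of $S^{d-1}$. For $s\ge 0$ let $\psi^\eta_s$ be the map on measures on $\mathcal M$ that leaves $x$ fixed and moves $u$ by $K^\eta_s$. Let $$\rho_\infty(dx,du)=c\,e^{-S(x)}\,dx\,\sigma(du),$$ where $\sigma$ is the surface measure of $S^{d-1}$ ($\sqrt g\,d\vartheta$ in spherical coordinates) and $c>0$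 is any constant (in particular the normalizing constant, when $e^{-S}$ is integrable). Then the flow $\varphi$ and the semigroup $K^\eta$ exist and are unique, and for every $\eta\in\mathbb R$ and every step size $\varepsilon\ge0$ the splitting scheme $$\rho_{(n+1)\varepsilon}=\psi^\eta_\varepsilon\big[\varphi_{\varepsilon*}\,\rho_{n\varepsilon}\big]$$ preserves $\rho_\infty$ exactly: $$\psi^\eta_\varepsilon[\varphi_{\varepsilon*}\rho_\infty]=\rho_\infty .$$ Moreover, the only source of bias is the discretization of the deterministic flow: if $\varphi_\varepsilon$ is replaced in the scheme by any measurable map $\Phi:\mathcal M\to\mathcal M$ with $\Phi_*\rho_\infty=\rho_\infty$, then $\psi^\eta_\varepsilon[\Phi_*\rho_\infty]=\rho_\infty$ as well (with $\Phi=\mathrm{id}$: the diffusion step alone preserves $\rho_\infty$). -/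

import Mathlib

open MeasureTheory ProbabilityTheory Filter Topology
open scoped NNReal ENNReal ContDiff RealInnerProductSpace

namespace MCLMC

/-- The configuration space `ℝ^d` with its Euclidean norm. -/
abbrev Conf (d : ℕ) : Type := EuclideanSpace ℝ (Fin d)

/-- The unit sphere `S^{d-1}` of velocities. -/
abbrev Vel (d : ℕ) : Type := Metric.sphere (0 : Conf d) 1

/-- The phase space `M = ℝ^d × S^{d-1}`. -/
abbrev Phase (d : ℕ) : Type := Conf d × Vel d

/-- The projector `P(u) = I - u uᵀ`, applied to a vector `v`. -/
noncomputable def proj {d : ℕ} (u v : Conf d) : Conf d := v - ⟪u, v⟫ • u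

/-- The force `f(x) = -∇S(x) / (d - 1)`. -/
noncomputable def force {d : ℕ} (S : Conf d → ℝ) (x : Conf d) : Conf d :=
  -(((d : ℝ) - 1)⁻¹ • gradient S x)

/-- `φ` is the flow on `M` of the ODE `x' = u`, `u' = P(u) f(x)`: for every `z`, the curve
`t ↦ φ t z`, `t ∈ ℝ`, solves the ODE and starts at `z`. -/
structure IsFlow {d : ℕ} (S : Conf d → ℝ) (φ : ℝ → Phase d → Phase d) : Prop where
  init : ∀ z, φ 0 z = z
  deriv_pos : ∀ z t, HasDerivAt (fun s => (φ s z).1) ((φ t z).2 : Conf d) t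
  deriv_vel : ∀ z t, HasDerivAt (fun s => ((φ s z).2 : Conf d))
    (proj ((φ t z).2 : Conf d) (force S (φ t z).1)) t

/-- The Laplace-Beltrami operator of the unit sphere, applied to the restriction to the sphere of
a function `G` on `ℝ^d`: the Euclidean Laplacian of the extension of that restriction which is
constant along rays. -/
noncomputable def sphereLaplacian {d : ℕ} (G : Conf d → ℝ) (u : Vel d) : ℝ :=
  Laplacian.laplacian (fun x : Conf d => G (‖x‖⁻¹ • x)) (u : Conf d)

/-- `K` is the transition semigroup of Brownian motion on the sphere with noise strength `η`, that
is, of the Stratonovich equation `du = η P(u) ∘ dW`: a semigroup of Markov kernels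
whose infinitesimal generator is `(η² / 2) Δ` on the smooth functions on the sphere (every such
function is the restriction of a smooth function `G` on `ℝ^d`). -/
structure IsSphereBrownian {d : ℕ} (η : ℝ) (K : ℝ≥0 → Kernel (Vel d) (Vel d)) : Prop where
  markov : ∀ t, IsMarkovKernel (K t)
  zero : K 0 = Kernel.id
  add : ∀ s t, K (s + t) = K t ∘ₖ K s
  generator : ∀ G : Conf d → ℝ, ContDiff ℝ ∞ G →
    TendstoUniformly
      (fun (t : ℝ≥0) (u : Vel d) => ((∫ v, G (v : Conf d) ∂(K t u)) - G (u : Conf d)) / (t : ℝ))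
      (fun u => η ^ 2 / 2 * sphereLaplacian G u)
      (𝓝[>] (0 : ℝ≥0))

/-- The density flow `ψ_s` of the diffusion-only dynamics, which keeps `x` fixed and moves `u`
by the transition semigroup `K`: it takes the law at time `t` to the law at time `t + s`. -/
noncomputable def diffusionFlow {d : ℕ} (K : ℝ≥0 → Kernel (Vel d) (Vel d)) (s : ℝ≥0)
    (μ : Measure (Phase d)) : Measure (Phase d) :=
  ((Kernel.id : Kernel (Conf d) (Conf d)) ∥ₖ K s) ∘ₘ μ

/-- One step of the drift-diffusion splitting: push forward by the deterministic map `Φ`, then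
apply the density flow `ψ_s` of the diffusion. The splitting scheme with step `s` has `Φ = φ_s`. -/
noncomputable def splittingStep {d : ℕ} (Φ : Phase d → Phase d)
    (K : ℝ≥0 → Kernel (Vel d) (Vel d)) (s : ℝ≥0) (μ : Measure (Phase d)) : Measure (Phase d) :=
  diffusionFlow K s (μ.map Φ)

/-- The distribution `c e^{-S(x)} dx ⊗ σ(du)` on `M`, where `σ` is the surface measure of the
sphere, `√g dϑ` in spherical coordinates. -/
noncomputable def rhoInf {d : ℕ} (S : Conf d → ℝ) (c : ℝ) : Measure (Phase d) :=
  ((volume : Measure (Conf d)).withDensity fun x => ENNReal.ofReal (c * Real.exp (-S x))).prod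
    (volume : Measure (Conf d)).toSphere

end MCLMC

/-!
The deterministic flow and the diffusion preserve `ρ∞ = c e^{-S(x)} dx σ(du)` separately, so every
composition of the two does.

**The deterministic flow.** The dynamics extends to the `C¹` field
`(x, v) ↦ (v, |v|² f(x) - ⟪v, f(x)⟫ v)` on `ℝ^d × ℝ^d` (`field`). It conserves `|v|`, and on `|v| = 1`
it moves `x` with speed one; so a cutoff far away and the Picard-Lindelöf theorem give global
existence, and Gronwall's inequality gives uniqueness (`existsUnique_isFlow`). The measure
`e^{-S(x)} dx dv` has zero divergence along this field (`div_fieldCoord`): this is where the factor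
`1 / (d - 1)` in the force enters. As `S` is only `C²`, the flow is merely locally Lipschitz, and a
Lipschitz test function `g` composed with `φ t` is again Lipschitz on bounded sets. Extended from the
sphere along rays, with a radial cutoff, it is differentiable almost everywhere, and integration by
parts for Lipschitz functions shows that `∫ g ∘ φ t dρ∞` has derivative zero in `t`
(`IsFlow.integral_comp_eq`, `IsFlow.map_rhoInf`).

**Existence of the spherical Brownian motion.** On polynomials the Laplace-Beltrami operator acts by
an explicit differential operator `polyLaplacian`, which preserves the homogeneous components. Hence
the polynomial functions on the sphere form a dense subspace of the continuous functions, on which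
`A = (η² / 2) Δ` is locally finite, and `u' = A u` is solved by exponentials of matrices. The maximum
principle makes the solution operators contractions; they extend to a semigroup of positive unital
operators on continuous functions (`IsPregenerator.exists_isSemigroup`), which the
Riesz-Markov-Kakutani theorem turns into Markov kernels (`exists_kernel_of_markovOperator`). The
maximum principle also shows that `1 - A` is onto, and that every smooth function `G` is the limit of
polynomial functions `w` with `A w → (η² / 2) Δ G` (`IsPregenerator.exists_approx`): so the generator
is the right one on all smooth functions.

**Uniqueness and invariance.** For a kernel semigroup `K` with this generator and a polynomial
solution `u` of `u' = A u`, the function `s ↦ ∫ u (t - s) d(K s x)` has right derivative zero, so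
`∫ u 0 d(K t x) = u t x` (`IsKernelSemigroup.integral_eq`), which determines `K`. The Laplacian of a
polynomial is the divergence of a field which is tangent to the spheres, so its integral over the unit
sphere vanishes (`integral_polyLaplacian`); hence `∫ u t dσ` is constant, and `σ` is invariant
(`IsSphereBrownian.comp_toSphere`). As the diffusion acts on the second factor of the product measure
`ρ∞` only, `ρ∞` is invariant as well (`diffusionFlow_rhoInf`).
-/

namespace MCLMC

section Dynamics

variable {d : ℕ} {S : Conf d → ℝ}

/-! ### The vector field of the deterministic dynamics -/

lemma hasDerivAt_prod_fst {E F : Type*} [NormedAddCommGroup E] [NormedSpace ℝ E]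
    [NormedAddCommGroup F] [NormedSpace ℝ F] {f : ℝ → E × F} {f' : E × F} {t : ℝ}
    (h : HasDerivAt f f' t) : HasDerivAt (fun s => (f s).1) f'.1 t :=
  (ContinuousLinearMap.fst ℝ E F).hasFDerivAt.comp_hasDerivAt t h

lemma hasDerivAt_prod_snd {E F : Type*} [NormedAddCommGroup E] [NormedSpace ℝ E]
    [NormedAddCommGroup F] [NormedSpace ℝ F] {f : ℝ → E × F} {f' : E × F} {t : ℝ}
    (h : HasDerivAt f f' t) : HasDerivAt (fun s => (f s).2) f'.2 t :=
  (ContinuousLinearMap.snd ℝ E F).hasFDerivAt.comp_hasDerivAt t h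

/-- The vector field `(x, v) ↦ (v, |v|² f(x) - ⟪v, f(x)⟫ v)` on `ℝ^d × ℝ^d`. It is a `C¹` extension of
the field of the dynamics on `ℝ^d × S^{d-1}`, and its flow conserves `|v|`. -/
noncomputable def field (S : Conf d → ℝ) (z : Conf d × Conf d) : Conf d × Conf d :=
  (z.2, ‖z.2‖ ^ 2 • force S z.1 - ⟪z.2, force S z.1⟫ • z.2)

/-- The inclusion of the phase space into `ℝ^d × ℝ^d`. -/
def incl (z : Phase d) : Conf d × Conf d := (z.1, (z.2 : Conf d))

@[simp] lemma incl_fst (z : Phase d) : (incl z).1 = z.1 := rfl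
@[simp] lemma incl_snd (z : Phase d) : (incl z).2 = (z.2 : Conf d) := rfl

lemma norm_vel (u : Vel d) : ‖(u : Conf d)‖ = 1 := by simp

lemma incl_injective : Function.Injective (incl : Phase d → Conf d × Conf d) := by
  rintro ⟨x, u⟩ ⟨y, v⟩ h
  simp only [incl, Prod.mk.injEq] at h
  exact Prod.ext h.1 (Subtype.ext h.2)

lemma isometry_incl : Isometry (incl : Phase d → Conf d × Conf d) := fun _ _ => rfl

lemma field_incl (z : Phase d) :
    field S (incl z) = ((z.2 : Conf d), proj (z.2 : Conf d) (force S z.1)) := by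
  simp [field, proj]

lemma contDiff_force (hS : ContDiff ℝ 2 S) : ContDiff ℝ 1 (force S) := by
  have h : ContDiff ℝ 1 (gradient S) :=
    (InnerProductSpace.toDual ℝ (Conf d)).symm.toContinuousLinearEquiv.contDiff.comp
      (hS.fderiv_right (m := 1) (by norm_num))
  exact (h.const_smul _).neg

lemma contDiff_field (hS : ContDiff ℝ 2 S) : ContDiff ℝ 1 (field S) := by
  have hf : ContDiff ℝ 1 fun z : Conf d × Conf d => force S z.1 :=
    (contDiff_force hS).comp contDiff_fst
  exact contDiff_snd.prodMk
    (((contDiff_snd.norm_sq ℝ).smul hf).sub ((contDiff_snd.inner ℝ hf).smul contDiff_snd))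

lemma inner_field_snd (z : Conf d × Conf d) : ⟪z.2, (field S z).2⟫ = 0 := by
  simp only [field, inner_sub_right, inner_smul_right, real_inner_self_eq_norm_sq]
  ring

lemma exists_lipschitzOnWith_field (hS : ContDiff ℝ 2 S) {K : Set (Conf d × Conf d)}
    (hK : IsCompact K) : ∃ C, LipschitzOnWith C (field S) K :=
  ((contDiff_field hS).locallyLipschitz.locallyLipschitzOn).exists_lipschitzOnWith_of_compact hK

/-! ### Existence and uniqueness of the deterministic flow -/

/-- The compact subset `{|x - x₀| ≤ R, |v| ≤ 1}` of `ℝ^d × ℝ^d`. -/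
def tube (x₀ : Conf d) (R : ℝ) : Set (Conf d × Conf d) :=
  Metric.closedBall x₀ R ×ˢ Metric.closedBall 0 1

lemma isCompact_tube (x₀ : Conf d) (R : ℝ) : IsCompact (tube x₀ R) :=
  (isCompact_closedBall x₀ R).prod (isCompact_closedBall 0 1)

lemma eqOn_of_hasDerivAt_field (hS : ContDiff ℝ 2 S) {x₀ : Conf d} {R T : ℝ} (hT : 0 < T)
    {α β : ℝ → Conf d × Conf d}
    (hα : ∀ t ∈ Set.Ioo (-T) T, HasDerivAt α (field S (α t)) t ∧ α t ∈ tube x₀ R)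
    (hβ : ∀ t ∈ Set.Ioo (-T) T, HasDerivAt β (field S (β t)) t ∧ β t ∈ tube x₀ R)
    (h : α 0 = β 0) : Set.EqOn α β (Set.Ioo (-T) T) := by
  obtain ⟨C, hC⟩ := exists_lipschitzOnWith_field hS (isCompact_tube x₀ R)
  exact ODE_solution_unique_of_mem_Ioo (v := fun _ => field S) (s := fun _ => tube x₀ R)
    (fun _ _ => hC) ⟨by linarith, hT⟩ hα hβ h

/-- On every bounded time interval the field has an integral curve through every point of the phase
space; it stays on the phase space and has speed one in the `x` variable. -/
lemma exists_curve_Ioo (hS : ContDiff ℝ 2 S) (z : Phase d) {T : ℝ} (hT : 0 < T) :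
    ∃ α : ℝ → Conf d × Conf d, α 0 = incl z ∧ ∀ t ∈ Set.Ioo (-T) T,
      HasDerivAt α (field S (α t)) t ∧ α t ∈ tube z.1 T ∧ ‖(α t).2‖ = 1 := by
  -- cut the field off outside a neighbourhood of the region that a curve can reach before time `T`
  let b₁ : ContDiffBump z.1 := ⟨T, T + 1, hT, by linarith⟩
  let b₂ : ContDiffBump (0 : Conf d) := ⟨1, 2, one_pos, by norm_num⟩
  let ψ : Conf d × Conf d → ℝ := fun y => b₁ y.1 * b₂ y.2
  let B : Conf d × Conf d → Conf d × Conf d := fun y => ψ y • field S y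
  have hψ : ContDiff ℝ 1 ψ :=
    (b₁.contDiff.comp contDiff_fst).mul (b₂.contDiff.comp contDiff_snd)
  have hψ01 : ∀ y, 0 ≤ ψ y ∧ ψ y ≤ 1 := fun y =>
    ⟨mul_nonneg b₁.nonneg b₂.nonneg, mul_le_one₀ b₁.le_one b₂.nonneg b₂.le_one⟩
  have hψ1 : ∀ y ∈ tube z.1 T, ψ y = 1 := fun y hy => by
    simp only [ψ]
    rw [b₁.one_of_mem_closedBall hy.1, b₂.one_of_mem_closedBall hy.2, one_mul]
  have hψc : HasCompactSupport ψ := by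
    refine HasCompactSupport.intro (K := Metric.closedBall z.1 (T + 1) ×ˢ Metric.closedBall 0 2)
      ((isCompact_closedBall _ _).prod (isCompact_closedBall _ _)) fun y hy => ?_
    by_cases h1 : y.1 ∈ Metric.closedBall z.1 (T + 1)
    · have h2 : y.2 ∉ Metric.closedBall (0 : Conf d) 2 := fun h2 => hy ⟨h1, h2⟩
      have : b₂ y.2 = 0 := b₂.zero_of_le_dist (le_of_lt (by simpa using h2))
      simp [ψ, this]
    · have : b₁ y.1 = 0 := b₁.zero_of_le_dist (le_of_lt (by simpa using h1))
      simp [ψ, this]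
  have hB : ContDiff ℝ 1 B := hψ.smul (contDiff_field hS)
  have hBc : HasCompactSupport B := hψc.smul_right
  obtain ⟨C, hC⟩ := hB.lipschitzWith_of_hasCompactSupport hBc one_ne_zero
  obtain ⟨M, hM⟩ := hB.continuous.bounded_above_of_compact_support hBc
  have hM0 : 0 ≤ M := (norm_nonneg _).trans (hM 0)
  obtain ⟨α, hα0, hα⟩ := (IsPicardLindelof.of_time_independent (f := B) (tmin := -T) (tmax := T)
    (t₀ := ⟨0, by linarith, hT.le⟩) (x₀ := incl z) (a := ⟨M * T, by positivity⟩) (r := 0)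
    (L := ⟨M, hM0⟩) (K := C) (fun x _ => hM x) (hC.lipschitzOnWith)
    (by simp; exact le_rfl)).exists_eq_forall_mem_Icc_hasDerivWithinAt₀
  have hα' : ∀ t ∈ Set.Ioo (-T) T, HasDerivAt α (B (α t)) t := fun t ht =>
    (hα t (Set.Ioo_subset_Icc_self ht)).hasDerivAt (Icc_mem_nhds ht.1 ht.2)
  have h0 : (0 : ℝ) ∈ Set.Ioo (-T) T := ⟨by linarith, hT⟩
  have hv : ∀ t ∈ Set.Ioo (-T) T, ‖(α t).2‖ = 1 := by
    intro t ht
    have hd : ∀ s ∈ Set.Ioo (-T) T, HasDerivAt (fun s => ‖(α s).2‖ ^ 2) 0 s := by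
      intro s hs
      have h := (hasDerivAt_prod_snd (hα' s hs)).norm_sq
      have : ⟪(α s).2, (B (α s)).2⟫ = 0 := by
        simp only [B, Prod.smul_snd, inner_smul_right, inner_field_snd, mul_zero]
      rwa [this, mul_zero] at h
    have := isOpen_Ioo.is_const_of_deriv_eq_zero isPreconnected_Ioo
      (fun s hs => (hd s hs).differentiableAt.differentiableWithinAt)
      (fun s hs => (hd s hs).deriv) ht h0
    have h1 : (α 0).2 = (z.2 : Conf d) := by rw [hα0]; rfl
    rw [h1, norm_vel] at this
    nlinarith [norm_nonneg (α t).2]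
  have hx : ∀ t ∈ Set.Ioo (-T) T, α t ∈ tube z.1 T := by
    intro t ht
    refine ⟨?_, by simp [hv t ht]⟩
    have := (convex_Ioo (-T) T).norm_image_sub_le_of_norm_hasDerivWithin_le (C := 1)
      (fun s hs => (hasDerivAt_prod_fst (hα' s hs)).hasDerivWithinAt) (fun s hs => ?_) h0 ht
    · have h1 : (α 0).1 = z.1 := by rw [hα0]; rfl
      rw [h1, one_mul, sub_zero, Real.norm_eq_abs] at this
      rw [Metric.mem_closedBall, dist_eq_norm]
      exact this.trans (abs_le.2 ⟨ht.1.le, ht.2.le⟩)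
    · simp only [B, Prod.smul_fst, field, norm_smul, hv s hs, mul_one]
      rw [Real.norm_eq_abs, abs_of_nonneg (hψ01 _).1]
      exact (hψ01 _).2
  refine ⟨α, hα0, fun t ht => ⟨?_, hx t ht, hv t ht⟩⟩
  have h := hα' t ht
  simp only [B] at h
  rwa [hψ1 _ (hx t ht), one_smul] at h

/-- The flow equations say that the trajectories are integral curves of `field`. -/
lemma isFlow_iff {φ : ℝ → Phase d → Phase d} : IsFlow S φ ↔ (∀ z, φ 0 z = z) ∧
    ∀ z t, HasDerivAt (fun s => incl (φ s z)) (field S (incl (φ t z))) t := by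
  constructor
  · intro h
    refine ⟨h.init, fun z t => ?_⟩
    rw [field_incl]
    exact (h.deriv_pos z t).prodMk (h.deriv_vel z t)
  · rintro ⟨h0, h⟩
    refine ⟨h0, fun z t => ?_, fun z t => ?_⟩
    · have := hasDerivAt_prod_fst (h z t)
      rwa [field_incl] at this
    · have := hasDerivAt_prod_snd (h z t)
      rwa [field_incl] at this

lemma exists_isFlow (hS : ContDiff ℝ 2 S) : ∃ φ, IsFlow S φ := by
  have H : ∀ z : Phase d, ∀ T : ℝ, ∃ α : ℝ → Conf d × Conf d, 0 < T → α 0 = incl z ∧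
      ∀ t ∈ Set.Ioo (-T) T,
        HasDerivAt α (field S (α t)) t ∧ α t ∈ tube z.1 T ∧ ‖(α t).2‖ = 1 := by
    intro z T
    by_cases hT : 0 < T
    · obtain ⟨α, hα⟩ := exists_curve_Ioo hS z hT
      exact ⟨α, fun _ => hα⟩
    · exact ⟨0, fun h => absurd h hT⟩
  choose α hα using H
  have hagree : ∀ z T T' t, |t| < T → |t| < T' → α z T t = α z T' t := by
    have key : ∀ z T T' t, T ≤ T' → |t| < T → α z T t = α z T' t := by
      intro z T T' t hle ht
      have hT : 0 < T := (abs_nonneg t).trans_lt ht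
      obtain ⟨a0, a1⟩ := hα z T hT
      obtain ⟨b0, b1⟩ := hα z T' (hT.trans_le hle)
      refine eqOn_of_hasDerivAt_field hS (x₀ := z.1) (R := T') hT
        (fun s hs => ⟨(a1 s hs).1, ?_⟩) (fun s hs => ?_) (a0.trans b0.symm) (abs_lt.1 ht)
      · exact Set.prod_mono (Metric.closedBall_subset_closedBall hle) le_rfl (a1 s hs).2.1
      · have hs' : s ∈ Set.Ioo (-T') T' := ⟨by linarith [hs.1], by linarith [hs.2]⟩
        exact ⟨(b1 s hs').1, (b1 s hs').2.1⟩
    intro z T T' t h h'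
    rcases le_total T T' with hle | hle
    · exact key z T T' t hle h
    · exact (key z T' T t hle h').symm
  have hmem : ∀ z t, ‖(α z (|t| + 1) t).2‖ = 1 := fun z t =>
    ((hα z (|t| + 1) (by positivity)).2 t (abs_lt.1 (by linarith))).2.2
  let φ : ℝ → Phase d → Phase d := fun t z =>
    ((α z (|t| + 1) t).1, ⟨(α z (|t| + 1) t).2, by simpa using hmem z t⟩)
  have hφ : ∀ t z, incl (φ t z) = α z (|t| + 1) t := fun t z => rfl
  refine ⟨φ, isFlow_iff.2 ⟨fun z => incl_injective ?_, fun z t => ?_⟩⟩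
  · rw [hφ]
    exact (hα z _ (by positivity)).1
  · rw [hφ]
    have h1 := ((hα z (|t| + 1) (by positivity)).2 t (abs_lt.1 (by linarith))).1
    refine h1.congr_of_eventuallyEq ?_
    have : ∀ᶠ s in 𝓝 t, |s| < |t| + 1 :=
      (continuous_abs.tendsto t).eventually (gt_mem_nhds (by linarith))
    filter_upwards [this] with s hs
    rw [hφ]
    exact hagree z _ _ s (by linarith) hs

section Flow

variable {φ : ℝ → Phase d → Phase d}

lemma IsFlow.hasDerivAt (h : IsFlow S φ) (z : Phase d) (t : ℝ) :
    HasDerivAt (fun s => incl (φ s z)) (field S (incl (φ t z))) t := (isFlow_iff.1 h).2 z t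

/-- Integral curves move with speed one in the position variable. -/
lemma norm_sub_le_of_curve {γ : ℝ → Phase d}
    (hγ : ∀ t, HasDerivAt (fun s => incl (γ s)) (field S (incl (γ t))) t) (s t : ℝ) :
    ‖(γ t).1 - (γ s).1‖ ≤ |t - s| := by
  have := convex_univ.norm_image_sub_le_of_norm_hasDerivWithin_le (C := 1) (x := s) (y := t)
    (fun r _ => (hasDerivAt_prod_fst (hγ r)).hasDerivWithinAt) (fun r _ => by simp [field])
    (Set.mem_univ _) (Set.mem_univ _)
  simpa using this

lemma mem_tube_of_curve {γ : ℝ → Phase d}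
    (hγ : ∀ t, HasDerivAt (fun s => incl (γ s)) (field S (incl (γ t))) t) {x₀ : Conf d} {R r t : ℝ}
    (h0 : ‖(γ 0).1 - x₀‖ ≤ R) (ht : |t| ≤ r) : incl (γ t) ∈ tube x₀ (R + r) := by
  refine ⟨?_, by simp⟩
  rw [Metric.mem_closedBall, dist_eq_norm, incl_fst]
  have := norm_sub_le_of_curve hγ 0 t
  rw [sub_zero] at this
  calc ‖(γ t).1 - x₀‖ = ‖((γ t).1 - (γ 0).1) + ((γ 0).1 - x₀)‖ := by congr 1; abel
    _ ≤ ‖(γ t).1 - (γ 0).1‖ + ‖(γ 0).1 - x₀‖ := norm_add_le _ _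
    _ ≤ R + r := by linarith

lemma curve_unique (hS : ContDiff ℝ 2 S) {γ δ : ℝ → Phase d}
    (hγ : ∀ t, HasDerivAt (fun s => incl (γ s)) (field S (incl (γ t))) t)
    (hδ : ∀ t, HasDerivAt (fun s => incl (δ s)) (field S (incl (δ t))) t)
    (h : γ 0 = δ 0) : γ = δ := by
  funext t
  apply incl_injective
  have hT : 0 < |t| + 1 := by positivity
  refine eqOn_of_hasDerivAt_field hS (x₀ := (γ 0).1) (R := 0 + (|t| + 1)) hT
    (α := fun t => incl (γ t)) (β := fun t => incl (δ t))
    (fun s hs => ⟨hγ s, mem_tube_of_curve hγ (by simp) (abs_lt.2 hs).le⟩)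
    (fun s hs => ⟨hδ s, mem_tube_of_curve hδ (by simp [h]) (abs_lt.2 hs).le⟩)
    (by simp only [h]) (abs_lt.1 (by linarith))

lemma existsUnique_isFlow (hS : ContDiff ℝ 2 S) :
    ∃! φ : ℝ → Phase d → Phase d, IsFlow S φ := by
  obtain ⟨φ, hφ⟩ := exists_isFlow hS
  refine ⟨φ, hφ, fun φ' hφ' => ?_⟩
  funext t z
  exact congrFun (curve_unique hS (hφ'.hasDerivAt z) (hφ.hasDerivAt z)
    (by rw [hφ'.init, hφ.init])) t

lemma IsFlow.add (h : IsFlow S φ) (hS : ContDiff ℝ 2 S) (t s : ℝ) (z : Phase d) :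
    φ (t + s) z = φ t (φ s z) := by
  refine congrFun (curve_unique hS (γ := fun t => φ (t + s) z) (δ := fun t => φ t (φ s z))
    (fun t => ?_) (h.hasDerivAt _) ?_) t
  · simpa using (h.hasDerivAt z (t + s)).comp_add_const t s
  · simp only [zero_add]
    rw [h.init]

lemma IsFlow.norm_fst_sub_le (h : IsFlow S φ) (s t : ℝ) (z : Phase d) :
    ‖(φ t z).1 - (φ s z).1‖ ≤ |t - s| :=
  norm_sub_le_of_curve (h.hasDerivAt z) s t

/-- Gronwall's inequality for the flow on a bounded part of the phase space. -/
lemma IsFlow.exists_lipschitzOnWith (h : IsFlow S φ) (hS : ContDiff ℝ 2 S) (R : ℝ) {t : ℝ}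
    (ht : 0 ≤ t) :
    ∃ C : ℝ≥0, LipschitzOnWith C (φ t) {z : Phase d | ‖z.1‖ ≤ R} := by
  obtain ⟨K, hK⟩ := exists_lipschitzOnWith_field hS (isCompact_tube (0 : Conf d) (R + t))
  refine ⟨⟨Real.exp (K * t), (Real.exp_pos _).le⟩, LipschitzOnWith.of_dist_le_mul fun z hz y hy => ?_⟩
  have hmem : ∀ z ∈ {z : Phase d | ‖z.1‖ ≤ R}, ∀ s ∈ Set.Ico 0 t,
      incl (φ s z) ∈ tube (0 : Conf d) (R + t) := fun z hz s hs =>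
    mem_tube_of_curve (h.hasDerivAt z) (by simpa [h.init] using hz)
      (by rw [abs_of_nonneg hs.1]; exact hs.2.le)
  have := dist_le_of_trajectories_ODE_of_mem (v := fun _ => field S)
    (s := fun _ => tube (0 : Conf d) (R + t)) (a := 0) (b := t) (δ := dist z y)
    (f := fun s => incl (φ s z)) (g := fun s => incl (φ s y)) (fun _ _ => hK)
    (HasDerivAt.continuousOn fun s _ => h.hasDerivAt z s)
    (fun s _ => (h.hasDerivAt z s).hasDerivWithinAt) (hmem z hz)
    (HasDerivAt.continuousOn fun s _ => h.hasDerivAt y s)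
    (fun s _ => (h.hasDerivAt y s).hasDerivWithinAt) (hmem y hy)
    (by simp only [h.init]; exact (isometry_incl.dist_eq z y).le) t ⟨ht, le_rfl⟩
  rw [isometry_incl.dist_eq, sub_zero, mul_comm] at this
  exact this

lemma IsFlow.continuous (h : IsFlow S φ) (hS : ContDiff ℝ 2 S) {t : ℝ} (ht : 0 ≤ t) :
    Continuous (φ t) := by
  rw [continuous_iff_continuousAt]
  intro z
  obtain ⟨C, hC⟩ := h.exists_lipschitzOnWith hS (‖z.1‖ + 1) ht
  refine hC.continuousOn.continuousAt ?_
  have : ∀ᶠ y : Phase d in 𝓝 z, ‖y.1‖ < ‖z.1‖ + 1 :=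
    (continuous_fst.norm.tendsto z).eventually (gt_mem_nhds (by linarith))
  filter_upwards [this] with y hy using hy.le

end Flow

end Dynamics

section Divergence

/-! ### Integration by parts -/

section Parts

variable {E : Type*} [NormedAddCommGroup E] [NormedSpace ℝ E]
  [MeasurableSpace E] [BorelSpace E] {μ : Measure E} [μ.IsAddHaarMeasure]

lemma integrable_lineDeriv_mul {h g : E → ℝ} {C : ℝ≥0} (hh : LipschitzWith C h)
    (hc : HasCompactSupport h) (hg : Continuous g) (e : E) :
    Integrable (fun x => lineDeriv ℝ h x e * g x) μ := by
  have hgi : IntegrableOn g (tsupport h) μ := hg.continuousOn.integrableOn_compact hc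
  have : IntegrableOn (fun x => lineDeriv ℝ h x e * g x) (tsupport h) μ := by
    refine Integrable.bdd_mul (c := C * ‖e‖) hgi
      (measurable_lineDeriv hh.continuous).aestronglyMeasurable
      (Eventually.of_forall fun x => norm_lineDeriv_le_of_lipschitz ℝ hh)
  refine (integrableOn_iff_integrable_of_support_subset fun x hx => ?_).1 this
  by_contra hxs
  have h0 : h =ᶠ[𝓝 x] fun _ => 0 := notMem_tsupport_iff_eventuallyEq.1 hxs
  have hd : HasFDerivAt h (0 : E →L[ℝ] ℝ) x := (hasFDerivAt_const 0 x).congr_of_eventuallyEq h0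
  apply hx
  show lineDeriv ℝ h x e * g x = 0
  rw [hd.differentiableAt.lineDeriv_eq_fderiv, hd.fderiv]
  simp

variable [FiniteDimensional ℝ E]

/-- Integration by parts of a compactly supported Lipschitz function against a `C¹` function. -/
lemma integral_lineDeriv_mul_contDiff {h g : E → ℝ} {C : ℝ≥0} (hh : LipschitzWith C h)
    (hc : HasCompactSupport h) (hg : ContDiff ℝ 1 g) (e : E) :
    ∫ x, lineDeriv ℝ h x e * g x ∂μ = - ∫ x, h x * lineDeriv ℝ g x e ∂μ := by
  -- multiply `g` by a cutoff which is one near the support of `h`, so that it becomes Lipschitz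
  obtain ⟨R, hR0, hR⟩ := hc.isBounded.subset_closedBall_lt 0 (0 : E)
  let b : ContDiffBump (0 : E) := ⟨R + 1, R + 2, by linarith, by linarith⟩
  have hb1 : ∀ x ∈ tsupport h, (fun y => b y * g y) =ᶠ[𝓝 x] g := by
    intro x hx
    have : Metric.ball (0 : E) (R + 1) ∈ 𝓝 x := Metric.isOpen_ball.mem_nhds
      (Metric.closedBall_subset_ball (by linarith) (hR hx))
    filter_upwards [this] with y hy
    rw [b.one_of_mem_closedBall (Metric.ball_subset_closedBall hy), one_mul]
  have hbg : ContDiff ℝ 1 fun y => b y * g y := b.contDiff.mul hg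
  obtain ⟨D, hD⟩ := hbg.lipschitzWith_of_hasCompactSupport b.hasCompactSupport.mul_right one_ne_zero
  replace hD : LipschitzWith D fun y => b y * g y := hD
  have key := LipschitzWith.integral_lineDeriv_mul_eq (μ := μ) hD hh hc e
  have e1 : ∀ x, lineDeriv ℝ (fun y => b y * g y) x e * h x = h x * lineDeriv ℝ g x e := by
    intro x
    by_cases hx : x ∈ tsupport h
    · have hgx := hb1 x hx
      have : lineDeriv ℝ (fun y => b y * g y) x e = lineDeriv ℝ g x e := by
        rw [(hbg.differentiable one_ne_zero x).lineDeriv_eq_fderiv,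
          (hg.differentiable one_ne_zero x).lineDeriv_eq_fderiv, hgx.fderiv_eq]
      rw [this, mul_comm]
    · rw [image_eq_zero_of_notMem_tsupport hx, mul_zero, zero_mul]
  have e2 : ∀ x, lineDeriv ℝ h x (-e) * (b x * g x) = -(lineDeriv ℝ h x e * g x) := by
    intro x
    rw [lineDeriv_neg]
    by_cases hx : x ∈ tsupport h
    · have : b x * g x = g x := (hb1 x hx).self_of_nhds
      rw [this, neg_mul]
    · have h0 : h =ᶠ[𝓝 x] fun _ => 0 := notMem_tsupport_iff_eventuallyEq.1 hx
      have : lineDeriv ℝ h x e = 0 := by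
        have hd : HasFDerivAt h (0 : E →L[ℝ] ℝ) x := (hasFDerivAt_const 0 x).congr_of_eventuallyEq h0
        rw [hd.differentiableAt.lineDeriv_eq_fderiv, hd.fderiv]; rfl
      rw [this]; simp
  rw [integral_congr_ae (Eventually.of_forall e1), integral_congr_ae (Eventually.of_forall e2),
    integral_neg] at key
  linarith

/-- The weak form of `div b = 0` for a `C¹` field `b = ∑ i, bᵢ eᵢ`, tested on Lipschitz functions. -/
lemma integral_fderiv_eq_zero_of_div_eq_zero {ι : Type*} [Fintype ι] {h : E → ℝ} {C : ℝ≥0}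
    (hh : LipschitzWith C h) (hc : HasCompactSupport h) (e : ι → E) {b : ι → E → ℝ}
    (hb : ∀ i, ContDiff ℝ 1 (b i)) (hdiv : ∀ x, ∑ i, lineDeriv ℝ (b i) x (e i) = 0) :
    ∫ x, fderiv ℝ h x (∑ i, b i x • e i) ∂μ = 0 := by
  have h1 : (fun x => fderiv ℝ h x (∑ i, b i x • e i)) =ᵐ[μ]
      fun x => ∑ i, lineDeriv ℝ h x (e i) * b i x := by
    filter_upwards [hh.ae_differentiableAt] with x hx
    rw [map_sum]
    refine Finset.sum_congr rfl fun i _ => ?_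
    rw [hx.lineDeriv_eq_fderiv, map_smul, smul_eq_mul, mul_comm]
  rw [integral_congr_ae h1, integral_finsetSum _
    fun i _ => integrable_lineDeriv_mul hh hc (hb i).continuous (e i)]
  simp_rw [fun i => integral_lineDeriv_mul_contDiff (μ := μ) hh hc (hb i) (e i)]
  rw [Finset.sum_neg_distrib, neg_eq_zero, ← integral_finsetSum]
  · simp_rw [← Finset.mul_sum, hdiv, mul_zero, integral_zero]
  · intro i _
    have hcont : Continuous fun x => lineDeriv ℝ (b i) x (e i) := by
      have : (fun x => lineDeriv ℝ (b i) x (e i)) = fun x => fderiv ℝ (b i) x (e i) :=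
        funext fun x => ((hb i).differentiable one_ne_zero x).lineDeriv_eq_fderiv
      rw [this]
      exact ((hb i).continuous_fderiv one_ne_zero).clm_apply continuous_const
    exact (hh.continuous.mul hcont).integrable_of_hasCompactSupport hc.mul_right

end Parts

/-! ### The divergence of the deterministic field -/

variable {d : ℕ} {S : Conf d → ℝ}

/-- The standard basis vectors of `ℝ^d × ℝ^d`, positions on the left and velocities on the right. -/
noncomputable def phaseBasis (d : ℕ) : Fin d ⊕ Fin d → Conf d × Conf d :=
  Sum.elim (fun i => (EuclideanSpace.single i 1, 0)) (fun i => (0, EuclideanSpace.single i 1))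

/-- The coordinates of `e^{-S}` times the field. -/
noncomputable def fieldCoord (S : Conf d → ℝ) : Fin d ⊕ Fin d → Conf d × Conf d → ℝ :=
  Sum.elim (fun i z => Real.exp (-S z.1) * (field S z).1 i)
    (fun i z => Real.exp (-S z.1) * (field S z).2 i)

lemma sum_smul_single (v : Conf d) : ∑ i, v i • EuclideanSpace.single i (1 : ℝ) = v := by
  have := (EuclideanSpace.basisFun (Fin d) ℝ).sum_repr v
  simpa using this

lemma sum_fieldCoord (z : Conf d × Conf d) :
    ∑ i, fieldCoord S i z • phaseBasis d i = Real.exp (-S z.1) • field S z := by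
  rw [Fintype.sum_sum_type]
  simp only [fieldCoord, phaseBasis, Sum.elim_inl, Sum.elim_inr, Prod.smul_mk, smul_zero,
    mul_smul]
  have h1 : ∑ i, (Real.exp (-S z.1) • (field S z).1 i • EuclideanSpace.single i (1 : ℝ), (0 : Conf d))
      = (Real.exp (-S z.1) • (field S z).1, 0) := by
    rw [← sum_smul_single (field S z).1, Finset.smul_sum]
    ext <;> simp [Prod.fst_sum, Prod.snd_sum, sum_smul_single]
  have h2 : ∑ i, ((0 : Conf d), Real.exp (-S z.1) • (field S z).2 i • EuclideanSpace.single i (1 : ℝ))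
      = (0, Real.exp (-S z.1) • (field S z).2) := by
    rw [← sum_smul_single (field S z).2, Finset.smul_sum]
    ext <;> simp [Prod.fst_sum, Prod.snd_sum, sum_smul_single]
  rw [h1, h2]
  ext <;> simp

lemma contDiff_fieldCoord (hS : ContDiff ℝ 2 S) (i : Fin d ⊕ Fin d) :
    ContDiff ℝ 1 (fieldCoord S i) := by
  have hw : ContDiff ℝ 1 fun z : Conf d × Conf d => Real.exp (-S z.1) :=
    (((hS.of_le (by norm_num)).comp contDiff_fst).neg).exp
  have hf := contDiff_field hS
  rcases i with i | i
  · exact hw.mul (contDiff_euclidean.1 hf.fst i)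
  · exact hw.mul (contDiff_euclidean.1 hf.snd i)

/-- The measure `e^{-S(x)} dx dv` has zero divergence along the field: the two nonzero terms are
`-⟪v, ∇S⟫`, from the density, and `-(d - 1) ⟪v, f⟫`, from the velocity equation. -/
lemma div_fieldCoord (hd : 2 ≤ d) (hS : ContDiff ℝ 2 S) (z : Conf d × Conf d) :
    ∑ i, lineDeriv ℝ (fieldCoord S i) z (phaseBasis d i) = 0 := by
  have hd0 : ((d : ℝ) - 1) ≠ 0 := by
    have : (2 : ℝ) ≤ d := by exact_mod_cast hd
    linarith
  set w := Real.exp (-S z.1) with hw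
  set f := force S z.1 with hf
  rw [Fintype.sum_sum_type]
  have h1 : ∀ i, lineDeriv ℝ (fieldCoord S (Sum.inl i)) z (phaseBasis d (Sum.inl i)) =
      w * (((d : ℝ) - 1) * (z.2 i * f i)) := by
    intro i
    have hSd : HasFDerivAt S (fderiv ℝ S z.1) z.1 :=
      (hS.differentiable (by norm_num) z.1).hasFDerivAt
    have hl := hSd.hasLineDerivAt (EuclideanSpace.single i 1)
    have hgrad : fderiv ℝ S z.1 (EuclideanSpace.single i 1) = -(((d : ℝ) - 1) * f i) := by
      have : fderiv ℝ S z.1 (EuclideanSpace.single i 1) =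
          ⟪gradient S z.1, EuclideanSpace.single i 1⟫ := by
        rw [gradient, InnerProductSpace.toDual_symm_apply]
      rw [this, EuclideanSpace.inner_single_right]
      simp only [hf, force, PiLp.neg_apply, PiLp.smul_apply, smul_eq_mul]
      field_simp
      simp
    rw [hgrad] at hl
    have : HasLineDerivAt ℝ (fieldCoord S (Sum.inl i))
        (w * (((d : ℝ) - 1) * (z.2 i * f i))) z (phaseBasis d (Sum.inl i)) := by
      have h2 := (HasDerivAt.neg hl).exp.mul_const (z.2 i)
      refine (h2.congr_deriv ?_).congr_of_eventuallyEq (Eventually.of_forall fun t => ?_)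
      · simp [hw]; ring
      · simp [fieldCoord, phaseBasis, field]
    exact this.lineDeriv
  have h2 : ∀ i, lineDeriv ℝ (fieldCoord S (Sum.inr i)) z (phaseBasis d (Sum.inr i)) =
      w * (z.2 i * f i - ⟪z.2, f⟫) := by
    intro i
    have hv : HasDerivAt (fun t : ℝ => z.2 + t • EuclideanSpace.single i (1 : ℝ))
        (EuclideanSpace.single i (1 : ℝ)) 0 := by
      simpa using ((hasDerivAt_id (0 : ℝ)).smul_const (EuclideanSpace.single i (1 : ℝ))).const_add z.2
    have hvi : HasDerivAt (fun t : ℝ => z.2 i + t) 1 0 := (hasDerivAt_id (0 : ℝ)).const_add _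
    have hin := hv.inner ℝ (hasDerivAt_const (0 : ℝ) f)
    have hn := hv.norm_sq
    have : HasLineDerivAt ℝ (fieldCoord S (Sum.inr i))
        (w * (z.2 i * f i - ⟪z.2, f⟫)) z (phaseBasis d (Sum.inr i)) := by
      have h2 := ((hn.mul_const (f i)).sub (hin.mul hvi)).const_mul w
      refine (h2.congr_deriv ?_).congr_of_eventuallyEq (Eventually.of_forall fun t => ?_)
      · simp [EuclideanSpace.inner_single_left, EuclideanSpace.inner_single_right]
        left; ring
      · simp [fieldCoord, phaseBasis, field, hw, hf]
    exact this.lineDeriv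
  simp_rw [h1, h2]
  rw [← Finset.mul_sum, ← Finset.mul_sum, ← Finset.mul_sum, Finset.sum_sub_distrib]
  have hin : ⟪z.2, f⟫ = ∑ i, z.2 i * f i := by
    simp [PiLp.inner_apply, mul_comm]
  rw [hin]
  simp
  ring

lemma integral_fderiv_field_eq_zero (hd : 2 ≤ d) (hS : ContDiff ℝ 2 S) {h : Conf d × Conf d → ℝ}
    {C : ℝ≥0} (hh : LipschitzWith C h) (hc : HasCompactSupport h) :
    ∫ z, Real.exp (-S z.1) * fderiv ℝ h z (field S z) ∂(volume.prod volume) = 0 := by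
  have := integral_fderiv_eq_zero_of_div_eq_zero (μ := (volume : Measure (Conf d)).prod volume)
    hh hc (phaseBasis d) (contDiff_fieldCoord hS) (div_fieldCoord hd hS)
  simpa only [sum_fieldCoord, map_smul, smul_eq_mul] using this

end Divergence

section Polar

variable {d : ℕ}

/-! ### Polar coordinates -/

open Classical in
/-- The radial projection `v ↦ v / |v|` to the unit sphere, with the value `u₀` at `0`. -/
noncomputable def radial (u₀ : Vel d) (v : Conf d) : Vel d :=
  if h : v = 0 then u₀ else ⟨‖v‖⁻¹ • v, by simp [norm_smul, h]⟩

lemma coe_radial (u₀ : Vel d) {v : Conf d} (h : v ≠ 0) :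
    (radial u₀ v : Conf d) = ‖v‖⁻¹ • v := by
  simp [radial, h]

lemma norm_smul_radial (u₀ : Vel d) {v : Conf d} (h : v ≠ 0) :
    ‖v‖ • (radial u₀ v : Conf d) = v := by
  rw [coe_radial u₀ h, smul_smul, mul_inv_cancel₀ (norm_ne_zero_iff.2 h), one_smul]

lemma radial_smul_vel (u₀ u : Vel d) {r : ℝ} (hr : 0 < r) : radial u₀ (r • (u : Conf d)) = u := by
  have h : (u : Conf d) ≠ 0 := ne_zero_of_mem_unit_sphere u
  ext1
  rw [coe_radial u₀ (smul_ne_zero hr.ne' h), norm_smul, norm_vel, mul_one, Real.norm_of_nonneg hr.le,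
    smul_smul, inv_mul_cancel₀ hr.ne', one_smul]

lemma measurable_radial (u₀ : Vel d) : Measurable (radial u₀) := by
  classical
  unfold radial
  refine Measurable.dite (s := {v : Conf d | v = 0}) (f := fun _ => u₀)
    (g := fun v => ⟨‖v.1‖⁻¹ • v.1, by simp [norm_smul, show v.1 ≠ 0 from v.2]⟩)
    measurable_const ?_ (measurableSet_singleton 0)
  refine Measurable.subtype_mk ?_
  fun_prop

lemma nontrivial_conf (u₀ : Vel d) : Nontrivial (Conf d) :=
  ⟨(u₀ : Conf d), 0, ne_zero_of_mem_unit_sphere u₀⟩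

/-- Polar coordinates: a radial density on `ℝ^d` projects to a multiple of the surface measure. -/
lemma map_radial_withDensity (u₀ : Vel d) {k : ℝ → ℝ≥0∞} (hk : Measurable k) :
    ((volume : Measure (Conf d)).withDensity fun v => k ‖v‖).map (radial u₀) =
      (∫⁻ r, k (r : ℝ) ∂(Measure.volumeIoiPow (Module.finrank ℝ (Conf d) - 1))) •
        (volume : Measure (Conf d)).toSphere := by
  have hne := nontrivial_conf u₀
  ext s hs
  rw [Measure.map_apply (measurable_radial u₀) hs, withDensity_apply _ (measurable_radial u₀ hs),
    ← lintegral_indicator (measurable_radial u₀ hs)]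
  have h1 : ∀ v : Conf d, (radial u₀ ⁻¹' s).indicator (fun v => k ‖v‖) v =
      s.indicator 1 (radial u₀ v) * k ‖v‖ := fun v => by
    by_cases hv : radial u₀ v ∈ s <;> simp [Set.indicator, hv]
  simp_rw [h1]
  have h2 : ∫⁻ v : Conf d, s.indicator 1 (radial u₀ v) * k ‖v‖ =
      ∫⁻ v : ({0}ᶜ : Set (Conf d)), s.indicator 1 (radial u₀ v.1) * k ‖v.1‖
        ∂((volume : Measure (Conf d)).comap (↑)) := by
    rw [lintegral_subtype_comap (measurableSet_singleton _).compl
      fun v => s.indicator 1 (radial u₀ v) * k ‖v‖, restrict_compl_singleton]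
  have h3 := (volume : Measure (Conf d)).measurePreserving_homeomorphUnitSphereProd.lintegral_comp_emb
    (Homeomorph.measurableEmbedding _) fun p => s.indicator 1 p.1 * k p.2
  have h4 : ∀ v : ({0}ᶜ : Set (Conf d)), radial u₀ v.1 = (homeomorphUnitSphereProd (Conf d) v).1 := by
    intro v
    ext1
    rw [coe_radial u₀ v.2]
    simp
  rw [h2]
  simp_rw [h4]
  simp only [homeomorphUnitSphereProd_apply_snd_coe] at h3
  rw [h3, lintegral_prod_mul (f := s.indicator 1) (g := fun r : Set.Ioi (0 : ℝ) => k r)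
    (measurable_one.indicator hs).aemeasurable
    (hk.comp measurable_subtype_coe).aemeasurable, lintegral_indicator_one hs,
    Measure.smul_apply, smul_eq_mul, mul_comm]

/-- The radial cutoff: a tent function of `r`, supported in `[1/2, 3/2]`. -/
noncomputable def tent (r : ℝ) : ℝ := max 0 (1 - 2 * |r - 1|)

lemma tent_nonneg (r : ℝ) : 0 ≤ tent r := le_max_left _ _

lemma tent_le_one (r : ℝ) : tent r ≤ 1 :=
  max_le zero_le_one (by linarith [abs_nonneg (r - 1)])

lemma tent_eq_zero {r : ℝ} (h : r ≤ 1 / 2 ∨ 3 / 2 ≤ r) : tent r = 0 := by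
  refine max_eq_left ?_
  rcases h with h | h
  · have := neg_le_abs (r - 1)
    linarith
  · have := le_abs_self (r - 1)
    linarith

lemma continuous_tent : Continuous tent := by unfold tent; fun_prop

lemma lipschitzWith_tent : LipschitzWith 2 tent := by
  refine LipschitzWith.const_max (LipschitzWith.of_dist_le_mul fun r s => ?_) 0
  have h1 : |r - 1| - |s - 1| ≤ |r - s| := by simpa using abs_sub_abs_le_abs_sub (r - 1) (s - 1)
  have h2 : |s - 1| - |r - 1| ≤ |r - s| := by
    rw [abs_sub_comm r s]; simpa using abs_sub_abs_le_abs_sub (s - 1) (r - 1)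
  rw [Real.dist_eq, Real.dist_eq]
  simp only [NNReal.coe_ofNat]
  rw [abs_le]
  constructor <;> linarith

/-- The radial weight `r · tent r`. -/
noncomputable def radialWeight (r : ℝ) : ℝ := r * tent r

lemma continuous_radialWeight : Continuous radialWeight := continuous_id.mul continuous_tent

lemma radialWeight_nonneg {r : ℝ} (hr : 0 ≤ r) : 0 ≤ radialWeight r := mul_nonneg hr (tent_nonneg r)

/-- A radial weight on `ℝ^d` projects to a positive multiple of the surface measure. -/
lemma exists_map_radial (u₀ : Vel d) {W : ℝ → ℝ} (hW : Continuous W) (hW0 : ∀ r, 0 ≤ r → 0 ≤ W r)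
    (hW1 : W 1 ≠ 0) (hW2 : ∀ r, 2 ≤ r → W r = 0) : ∃ C : ℝ≥0∞, C ≠ 0 ∧ C ≠ ⊤ ∧
    ((volume : Measure (Conf d)).withDensity fun v => ENNReal.ofReal (W ‖v‖)).map
      (radial u₀) = C • (volume : Measure (Conf d)).toSphere := by
  have hne := nontrivial_conf u₀
  have hC := map_radial_withDensity u₀ (k := fun r => ENNReal.ofReal (W r))
    hW.measurable.ennreal_ofReal
  generalize (∫⁻ r, ENNReal.ofReal (W ((r : Set.Ioi (0 : ℝ)) : ℝ))
      ∂(Measure.volumeIoiPow (Module.finrank ℝ (Conf d) - 1))) = C at hC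
  have key : ∫⁻ v : Conf d, ENNReal.ofReal (W ‖v‖) =
      C * (volume : Measure (Conf d)).toSphere Set.univ := by
    have := congrArg (fun m : Measure (Vel d) => m Set.univ) hC
    simpa only [Measure.map_apply (measurable_radial u₀) MeasurableSet.univ, Set.preimage_univ,
      withDensity_apply _ MeasurableSet.univ, Measure.restrict_univ, Measure.smul_apply,
      smul_eq_mul] using this
  have hpos : (volume : Measure (Conf d)).toSphere Set.univ ≠ 0 :=
    Measure.measure_univ_ne_zero.2 (Measure.toSphere_ne_zero _)
  have hcont : Continuous fun v : Conf d => W ‖v‖ := hW.comp continuous_norm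
  refine ⟨C, fun h0 => ?_, fun h0 => ?_, hC⟩
  · have hcont' : Continuous fun v : Conf d => ENNReal.ofReal (W ‖v‖) :=
      ENNReal.continuous_ofReal.comp hcont
    rw [h0, zero_mul, lintegral_eq_zero_iff hcont'.measurable] at key
    have h1 : ENNReal.ofReal (W ‖(u₀ : Conf d)‖) = 0 :=
      congrFun ((hcont'.ae_eq_iff_eq volume continuous_const).1 key) (u₀ : Conf d)
    rw [norm_vel] at h1
    exact hW1 (le_antisymm (ENNReal.ofReal_eq_zero.1 h1) (hW0 1 zero_le_one))
  · have hint : Integrable (fun v : Conf d => W ‖v‖) := by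
      refine hcont.integrable_of_hasCompactSupport
        (HasCompactSupport.intro (isCompact_closedBall (0 : Conf d) 2) fun v hv => ?_)
      exact hW2 _ (by simpa using (lt_of_not_ge (by simpa using hv)).le)
    refine hint.lintegral_lt_top.ne ?_
    rw [key, h0, ENNReal.top_mul hpos]

lemma exists_map_radialWeight (u₀ : Vel d) : ∃ C : ℝ≥0∞, C ≠ 0 ∧ C ≠ ⊤ ∧
    ((volume : Measure (Conf d)).withDensity fun v => ENNReal.ofReal (radialWeight ‖v‖)).map
      (radial u₀) = C • (volume : Measure (Conf d)).toSphere :=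
  exists_map_radial u₀ continuous_radialWeight (fun _ => radialWeight_nonneg)
    (by simp [radialWeight, tent])
    fun r hr => by simp [radialWeight, tent_eq_zero (Or.inr (by linarith : 3 / 2 ≤ r))]

end Polar

section Regularity

variable {d : ℕ} {S : Conf d → ℝ}

/-- The invariant measure, up to a factor, as the image of a measure on `ℝ^d × ℝ^d` with a
density. -/
lemma exists_integral_rhoInf (hS : ContDiff ℝ 2 S) {c : ℝ} (hc : 0 < c) (u₀ : Vel d) :
    ∃ C : ℝ, C ≠ 0 ∧ ∀ Q : Phase d → ℝ, StronglyMeasurable Q →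
      ∫ z : Conf d × Conf d, (c * radialWeight ‖z.2‖ * Q (z.1, radial u₀ z.2)) * Real.exp (-S z.1)
        ∂(volume.prod volume) = C * ∫ z, Q z ∂(rhoInf S c) := by
  obtain ⟨C, hC0, hCt, hC⟩ := exists_map_radialWeight u₀
  refine ⟨C.toReal, ENNReal.toReal_ne_zero.2 ⟨hC0, hCt⟩, fun Q hQ => ?_⟩
  have hm1 : Measurable fun x => ENNReal.ofReal (c * Real.exp (-S x)) := by
    have := hS.continuous
    fun_prop
  have hm2 : Measurable fun v : Conf d => ENNReal.ofReal (radialWeight ‖v‖) :=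
    (continuous_radialWeight.measurable.comp measurable_norm).ennreal_ofReal
  set μ₁ := (volume : Measure (Conf d)).withDensity fun x => ENNReal.ofReal (c * Real.exp (-S x))
    with hμ₁
  set μ₂ := (volume : Measure (Conf d)).withDensity fun v => ENNReal.ofReal (radialWeight ‖v‖)
    with hμ₂
  have hmap : (μ₁.prod μ₂).map (Prod.map id (radial u₀)) = C • rhoInf S c := by
    have : SFinite (μ₂.map (radial u₀)) := inferInstance
    rw [← Measure.map_prod_map _ _ measurable_id (measurable_radial u₀), Measure.map_id, hC,
      Measure.prod_smul_right]
    rfl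
  have h1 : ∫ z, Q z ∂(C • rhoInf S c) = ∫ z, Q (z.1, radial u₀ z.2) ∂(μ₁.prod μ₂) := by
    rw [← hmap, integral_map (measurable_id.prodMap (measurable_radial u₀)).aemeasurable
      hQ.aestronglyMeasurable]
    rfl
  rw [integral_smul_measure, smul_eq_mul] at h1
  have hm3 : Measurable fun z : Conf d × Conf d =>
      ENNReal.ofReal (c * Real.exp (-S z.1)) * ENNReal.ofReal (radialWeight ‖z.2‖) :=
    (hm1.comp measurable_fst).mul (hm2.comp measurable_snd)
  rw [h1, hμ₁, hμ₂, prod_withDensity hm1 hm2, integral_withDensity_eq_integral_toReal_smul hm3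
    (Eventually.of_forall fun z => ENNReal.mul_lt_top ENNReal.ofReal_lt_top ENNReal.ofReal_lt_top)]
  refine integral_congr_ae (Eventually.of_forall fun z => ?_)
  simp only [ENNReal.toReal_mul, smul_eq_mul]
  rw [ENNReal.toReal_ofReal (by positivity), ENNReal.toReal_ofReal (radialWeight_nonneg (norm_nonneg _))]
  ring

/-! ### Invariance under the deterministic flow -/

section Lipschitz

variable {α : Type*} [PseudoMetricSpace α]

lemma exists_lipschitzWith_mul {f g : α → ℝ} {s : Set α} {A B : ℝ≥0} {M : ℝ}
    (hf : LipschitzWith A f) (hf1 : ∀ x, |f x| ≤ 1) (hfs : ∀ x ∉ s, f x = 0)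
    (hg : LipschitzOnWith B g s) (hg1 : ∀ x, |g x| ≤ M) :
    ∃ C, LipschitzWith C fun x => f x * g x := by
  have hM : ∀ x, |g x| ≤ M.toNNReal := fun x => (hg1 x).trans (Real.le_coe_toNNReal M)
  refine ⟨B + A * M.toNNReal, LipschitzWith.of_dist_le_mul fun x y => ?_⟩
  have hfxy : |f x - f y| ≤ A * dist x y := by
    rw [← Real.dist_eq]
    exact hf.dist_le_mul x y
  have hB : 0 ≤ (B : ℝ) * dist x y := by positivity
  have hA : 0 ≤ (A : ℝ) * dist x y := by positivity
  rw [Real.dist_eq]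
  push_cast
  by_cases hx : x ∈ s
  · by_cases hy : y ∈ s
    · have hgxy : |g x - g y| ≤ B * dist x y := by
        rw [← Real.dist_eq]
        exact hg.dist_le_mul x hx y hy
      calc |f x * g x - f y * g y| = |f x * (g x - g y) + (f x - f y) * g y| := by ring_nf
        _ ≤ |f x| * |g x - g y| + |f x - f y| * |g y| := by
            rw [← abs_mul, ← abs_mul]; exact abs_add_le _ _
        _ ≤ 1 * (B * dist x y) + (A * dist x y) * M.toNNReal := by
            gcongr
            · exact hf1 x
            · exact hM y
        _ = (B + A * M.toNNReal) * dist x y := by ring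
    · have : f x * g x - f y * g y = (f x - f y) * g x := by rw [hfs y hy]; ring
      rw [this, abs_mul]
      calc |f x - f y| * |g x| ≤ (A * dist x y) * M.toNNReal := by gcongr; exact hM x
        _ ≤ (B + A * M.toNNReal) * dist x y := by linarith
  · have : f x * g x - f y * g y = (f x - f y) * g y := by rw [hfs x hx]; ring
    rw [this, abs_mul]
    calc |f x - f y| * |g y| ≤ (A * dist x y) * M.toNNReal := by gcongr; exact hM y
      _ ≤ (B + A * M.toNNReal) * dist x y := by linarith

end Lipschitz

lemma lipschitzOnWith_radial (u₀ : Vel d) :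
    LipschitzOnWith 4 (radial u₀) {v : Conf d | 1 / 2 ≤ ‖v‖} := by
  refine LipschitzOnWith.of_dist_le_mul fun v hv w hw => ?_
  simp only [Set.mem_ofPred_eq] at hv hw
  have hv0 : v ≠ 0 := norm_pos_iff.1 (by linarith)
  have hw0 : w ≠ 0 := norm_pos_iff.1 (by linarith)
  have hvp : 0 < ‖v‖ := norm_pos_iff.2 hv0
  have hwp : 0 < ‖w‖ := norm_pos_iff.2 hw0
  rw [Subtype.dist_eq, coe_radial u₀ hv0, coe_radial u₀ hw0, dist_eq_norm, dist_eq_norm]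
  have h1 : ‖v‖⁻¹ • v - ‖w‖⁻¹ • w = ‖v‖⁻¹ • ((v - w) + (1 - ‖v‖ * ‖w‖⁻¹) • w) := by
    rw [sub_smul, one_smul, sub_add_sub_cancel, smul_sub, smul_smul, ← mul_assoc,
      inv_mul_cancel₀ hvp.ne', one_mul]
  have h2 : ‖(1 - ‖v‖ * ‖w‖⁻¹) • w‖ ≤ ‖v - w‖ := by
    have : (1 - ‖v‖ * ‖w‖⁻¹) = (‖w‖ - ‖v‖) * ‖w‖⁻¹ := by field_simp
    rw [norm_smul, this, norm_mul, norm_inv, norm_norm, mul_assoc, inv_mul_cancel₀ hwp.ne', mul_one,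
      Real.norm_eq_abs, norm_sub_rev]
    exact abs_norm_sub_norm_le w v
  have h3 : ‖v‖⁻¹ ≤ 2 := by
    rw [inv_le_comm₀ hvp two_pos]; linarith
  rw [h1, norm_smul, norm_inv, norm_norm]
  calc ‖v‖⁻¹ * ‖(v - w) + (1 - ‖v‖ * ‖w‖⁻¹) • w‖ ≤ 2 * (‖v - w‖ + ‖v - w‖) := by
        gcongr
        exact (norm_add_le _ _).trans (by gcongr)
    _ = 4 * ‖v - w‖ := by ring

/-- The extension of a function on the phase space to `ℝ^d × ℝ^d` along rays in the velocity, cut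
off near the origin and near infinity. -/
noncomputable def rayExtension (u₀ : Vel d) (h : Phase d → ℝ) (z : Conf d × Conf d) : ℝ :=
  tent ‖z.2‖ * h (z.1, radial u₀ z.2)

lemma hasCompactSupport_rayExtension (u₀ : Vel d) {h : Phase d → ℝ} {R : ℝ}
    (hR : ∀ z, R < ‖z.1‖ → h z = 0) : HasCompactSupport (rayExtension u₀ h) := by
  refine HasCompactSupport.intro (K := Metric.closedBall 0 R ×ˢ Metric.closedBall 0 2)
    ((isCompact_closedBall _ _).prod (isCompact_closedBall _ _)) fun z hz => ?_
  by_cases h1 : z.1 ∈ Metric.closedBall (0 : Conf d) R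
  · have h2 : z.2 ∉ Metric.closedBall (0 : Conf d) 2 := fun h2 => hz ⟨h1, h2⟩
    have h3 : 2 < ‖z.2‖ := by simpa using h2
    simp [rayExtension, tent_eq_zero (Or.inr (by linarith : 3 / 2 ≤ ‖z.2‖))]
  · have h3 : R < ‖z.1‖ := by simpa using h1
    simp [rayExtension, hR (z.1, radial u₀ z.2) h3]

lemma exists_lipschitzWith_rayExtension (u₀ : Vel d) {h : Phase d → ℝ} {R M : ℝ} {B : ℝ≥0}
    (hR : ∀ z, R < ‖z.1‖ → h z = 0) (hM : ∀ z, |h z| ≤ M)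
    (hh : LipschitzOnWith B h {z | ‖z.1‖ ≤ R + 1}) :
    ∃ C, LipschitzWith C (rayExtension u₀ h) := by
  -- a second cutoff, equal to one where `h` does not vanish
  let ξ : Conf d × Conf d → ℝ := fun z => max 0 (min 1 (R + 1 - ‖z.1‖))
  have hξL : LipschitzWith 1 ξ := by
    refine LipschitzWith.const_max (LipschitzWith.const_min ?_ 1) 0
    have : LipschitzWith 1 fun z : Conf d × Conf d => ‖z.1‖ := by
      have h : LipschitzWith (1 * 1) fun z : Conf d × Conf d => ‖z.1‖ :=
        lipschitzWith_one_norm.comp LipschitzWith.prod_fst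
      rwa [one_mul] at h
    simpa using (LipschitzWith.const (R + 1)).sub this
  have hξ1 : ∀ z, |ξ z| ≤ 1 := fun z => by
    rw [abs_of_nonneg (le_max_left _ _)]
    exact max_le zero_le_one (min_le_left _ _)
  have htL : LipschitzWith 2 fun z : Conf d × Conf d => tent ‖z.2‖ := by
    have h : LipschitzWith (2 * (1 * 1)) fun z : Conf d × Conf d => tent ‖z.2‖ :=
      lipschitzWith_tent.comp (lipschitzWith_one_norm.comp LipschitzWith.prod_snd)
    rwa [one_mul, mul_one] at h
  have ht1 : ∀ z : Conf d × Conf d, |tent ‖z.2‖| ≤ 1 := fun z => by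
    rw [abs_of_nonneg (tent_nonneg _)]
    exact tent_le_one _
  obtain ⟨A, hA⟩ := exists_lipschitzWith_mul (s := Set.univ) hξL hξ1 (by simp)
    htL.lipschitzOnWith ht1
  have hrad : LipschitzOnWith (B * 4) (fun z : Conf d × Conf d => h (z.1, radial u₀ z.2))
      {z | ‖z.1‖ ≤ R + 1 ∧ 1 / 2 ≤ ‖z.2‖} := by
    have h1 : LipschitzOnWith 4 (fun z : Conf d × Conf d => ((z.1, radial u₀ z.2) : Phase d))
        {z | ‖z.1‖ ≤ R + 1 ∧ 1 / 2 ≤ ‖z.2‖} := by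
      refine LipschitzOnWith.of_dist_le_mul fun y hy z hz => ?_
      rw [Prod.dist_eq]
      refine max_le ?_ ?_
      · calc dist y.1 z.1 ≤ dist y z := le_max_left _ _
          _ ≤ 4 * dist y z := by linarith [dist_nonneg (x := y) (y := z)]
      · calc dist (radial u₀ y.2) (radial u₀ z.2) ≤ (4 : ℝ≥0) * dist y.2 z.2 :=
              (lipschitzOnWith_radial u₀).dist_le_mul _ hy.2 _ hz.2
          _ ≤ (4 : ℝ≥0) * dist y z := by gcongr; exact le_max_right _ _
    exact hh.comp h1 fun z hz => hz.1
  have hzero : ∀ z ∉ {z : Conf d × Conf d | ‖z.1‖ ≤ R + 1 ∧ 1 / 2 ≤ ‖z.2‖},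
      ξ z * tent ‖z.2‖ = 0 := fun z hz => by
    rcases not_and_or.1 hz with hz | hz
    · have : ξ z = 0 := max_eq_left ((min_le_right _ _).trans (by linarith [not_le.1 hz]))
      simp [this]
    · simp [tent_eq_zero (Or.inl (not_le.1 hz).le)]
  obtain ⟨C, hC⟩ := exists_lipschitzWith_mul hA
    (fun z => by rw [abs_mul]; exact mul_le_one₀ (hξ1 z) (abs_nonneg _) (ht1 z))
    hzero hrad (fun z => hM _)
  have heq : rayExtension u₀ h = fun z => ξ z * tent ‖z.2‖ * h (z.1, radial u₀ z.2) := by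
    ext z
    by_cases hz : R < ‖z.1‖
    · simp [rayExtension, hR (z.1, radial u₀ z.2) hz]
    · have : ξ z = 1 := by
        have : min 1 (R + 1 - ‖z.1‖) = 1 := min_eq_left (by linarith)
        simp [ξ, this]
      simp [rayExtension, this]
  exact ⟨C, by rwa [heq]⟩

section Flow

variable {φ : ℝ → Phase d → Phase d}

/-- Along the flow, the derivative of the extension of `h` in the direction of the field is the
derivative of `h`. -/
lemma IsFlow.hasDerivAt_rayExtension (hφ : IsFlow S φ) (u₀ : Vel d) {h : Phase d → ℝ}
    {z : Conf d × Conf d} (hz : DifferentiableAt ℝ (rayExtension u₀ h) z) :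
    HasDerivAt (fun s => radialWeight ‖z.2‖ * h (φ s (z.1, radial u₀ z.2)))
      (fderiv ℝ (rayExtension u₀ h) z (field S z)) 0 := by
  by_cases hv : z.2 = 0
  · have : field S z = 0 := by simp [field, hv]
    simp only [hv, norm_zero, radialWeight, zero_mul, this, map_zero]
    exact hasDerivAt_const _ _
  set r := ‖z.2‖ with hr
  have hrp : 0 < r := norm_pos_iff.2 hv
  set y : Phase d := (z.1, radial u₀ z.2) with hy
  -- the curve through `z` obtained by scaling the velocity of the trajectory of `y`
  let γ : ℝ → Conf d × Conf d := fun s => ((φ s y).1, r • ((φ s y).2 : Conf d))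
  have hγ0 : γ 0 = z := by
    simp only [γ, hφ.init, hy, hr]
    rw [norm_smul_radial u₀ hv]
  have hγ : HasDerivAt γ (r⁻¹ • field S z) 0 := by
    have h0 := hφ.hasDerivAt y 0
    have h1 := (hasDerivAt_prod_fst h0).prodMk ((hasDerivAt_prod_snd h0).const_smul r)
    have hz2 : z.2 = r • (radial u₀ z.2 : Conf d) := (norm_smul_radial u₀ hv).symm
    refine h1.congr_deriv (Eq.symm ?_)
    rw [hφ.init]
    ext1
    · simp only [field, incl, hy, Prod.smul_fst]
      conv_lhs => rw [hz2]
      rw [smul_smul, inv_mul_cancel₀ hrp.ne', one_smul]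
    · rw [field_incl]
      simp only [field, Prod.smul_snd, proj, ← hr, hy]
      conv_lhs => rw [hz2]
      simp only [inner_smul_left, smul_sub, smul_smul, conj_trivial]
      congr 2
      · field_simp
      · field_simp
  have hcomp : HasDerivAt (fun s => rayExtension u₀ h (γ s))
      (fderiv ℝ (rayExtension u₀ h) z (r⁻¹ • field S z)) 0 := by
    rw [← hγ0] at hz
    have := hz.hasFDerivAt.comp_hasDerivAt 0 hγ
    rwa [hγ0] at this
  have h2 : (fun s => radialWeight r * h (φ s y)) = fun s => r * rayExtension u₀ h (γ s) := by
    ext s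
    simp only [rayExtension, γ, radialWeight, radial_smul_vel u₀ _ hrp, norm_smul, norm_vel,
      Real.norm_of_nonneg hrp.le, mul_one]
    ring
  rw [h2]
  refine (hcomp.const_mul r).congr_deriv ?_
  rw [map_smul, smul_eq_mul, mul_inv_cancel_left₀ hrp.ne']

/-- Reversal of the velocity reverses time. -/
noncomputable def flip (z : Phase d) : Phase d := (z.1, -z.2)

lemma isometry_flip : Isometry (flip : Phase d → Phase d) := by
  refine Isometry.of_dist_eq fun z y => ?_
  simp [flip, Prod.dist_eq, Subtype.dist_eq, dist_neg_neg]

lemma flip_flip (z : Phase d) : flip (flip z) = z := by simp [flip]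

lemma IsFlow.neg (hφ : IsFlow S φ) (hS : ContDiff ℝ 2 S) (t : ℝ) (z : Phase d) :
    φ (-t) z = flip (φ t (flip z)) := by
  have h := curve_unique hS (γ := fun s => φ s z) (δ := fun s => flip (φ (-s) (flip z)))
    (hφ.hasDerivAt z) (fun s => ?_) (by simp [hφ.init, flip_flip])
  · simpa using congrFun h (-t)
  · have h0 := (hφ.hasDerivAt (flip z) (-s)).scomp s (hasDerivAt_neg s)
    have h1 := (hasDerivAt_prod_fst h0).prodMk (hasDerivAt_prod_snd h0).neg
    refine h1.congr_deriv ?_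
    rw [field_incl, field_incl]
    simp [flip, proj]

lemma IsFlow.exists_lipschitzOnWith' (hφ : IsFlow S φ) (hS : ContDiff ℝ 2 S) (R t : ℝ) :
    ∃ C : ℝ≥0, LipschitzOnWith C (φ t) {z : Phase d | ‖z.1‖ ≤ R} := by
  rcases le_total 0 t with ht | ht
  · exact hφ.exists_lipschitzOnWith hS R ht
  · obtain ⟨C, hC⟩ := hφ.exists_lipschitzOnWith hS R (neg_nonneg.2 ht)
    refine ⟨C, LipschitzOnWith.of_dist_le_mul fun y hy z hz => ?_⟩
    have h : ∀ z, φ t z = flip (φ (-t) (flip z)) := fun z => by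
      rw [← hφ.neg hS, neg_neg]
    calc dist (φ t y) (φ t z) = dist (φ (-t) (flip y)) (φ (-t) (flip z)) := by
          rw [h y, h z, isometry_flip.dist_eq]
      _ ≤ C * dist (flip y) (flip z) := hC.dist_le_mul (flip y) hy (flip z) hz
      _ = C * dist y z := by rw [isometry_flip.dist_eq]

lemma IsFlow.continuous' (hφ : IsFlow S φ) (hS : ContDiff ℝ 2 S) (t : ℝ) : Continuous (φ t) := by
  rcases le_total 0 t with ht | ht
  · exact hφ.continuous hS ht
  · have h : φ t = fun z => flip (φ (-t) (flip z)) := funext fun z => by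
      rw [← hφ.neg hS, neg_neg]
    rw [h]
    exact isometry_flip.continuous.comp
      ((hφ.continuous hS (neg_nonneg.2 ht)).comp isometry_flip.continuous)

end Flow

end Regularity

section Liouville

variable {d : ℕ} {S : Conf d → ℝ} {φ : ℝ → Phase d → Phase d}

lemma IsFlow.sub_le_norm_fst (hφ : IsFlow S φ) (t : ℝ) (z : Phase d) :
    ‖z.1‖ - |t| ≤ ‖(φ t z).1‖ := by
  have h := hφ.norm_fst_sub_le 0 t z
  rw [hφ.init, sub_zero] at h
  have h2 := norm_sub_norm_le z.1 (φ t z).1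
  rw [norm_sub_rev] at h2
  linarith

/-- The flow has bounded speed on bounded parts of the phase space, for bounded times. -/
lemma IsFlow.exists_dist_le (hφ : IsFlow S φ) (hS : ContDiff ℝ 2 S) (R t : ℝ) :
    ∃ M : ℝ, 0 ≤ M ∧ ∀ z : Phase d, ‖z.1‖ ≤ R → ∀ s, |s| ≤ 1 →
      dist (φ (t + s) z) (φ t z) ≤ M * |s| := by
  obtain ⟨M, hM⟩ := (isCompact_tube (0 : Conf d) (R + (|t| + 1))).exists_bound_of_continuousOn
    (contDiff_field hS).continuous.continuousOn
  refine ⟨max M 0, le_max_right _ _, fun z hz s hs => ?_⟩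
  have hs' := abs_le.1 hs
  rw [← isometry_incl.dist_eq, dist_eq_norm]
  have hmem : ∀ r ∈ Set.Icc (t - 1) (t + 1), ‖field S (incl (φ r z))‖ ≤ max M 0 := fun r hr => by
    refine (hM _ (mem_tube_of_curve (hφ.hasDerivAt z) (by simpa [hφ.init] using hz) ?_)).trans
      (le_max_left _ _)
    have : |r - t| ≤ 1 := abs_le.2 ⟨by linarith [hr.1], by linarith [hr.2]⟩
    have := abs_sub_abs_le_abs_sub r t
    linarith
  have := (convex_Icc (t - 1) (t + 1)).norm_image_sub_le_of_norm_hasDerivWithin_le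
    (fun r _ => (hφ.hasDerivAt z r).hasDerivWithinAt) hmem
    (x := t) (y := t + s) ⟨by linarith, by linarith⟩ ⟨by linarith, by linarith⟩
  simpa using this

/-- Invariance tested on Lipschitz functions: the derivative in `t` of the left side is the integral
of the derivative of a Lipschitz function in the direction of a divergence-free field. -/
lemma IsFlow.integral_comp_eq (hφ : IsFlow S φ) (hd : 2 ≤ d) (hS : ContDiff ℝ 2 S) {c : ℝ}
    (hc : 0 < c) {g : Phase d → ℝ} {L : ℝ≥0} (hg : LipschitzWith L g) {M R : ℝ}
    (hgM : ∀ z, |g z| ≤ M) (hgR : ∀ z, R < ‖z.1‖ → g z = 0) (t : ℝ) :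
    ∫ z, g (φ t z) ∂(rhoInf S c) = ∫ z, g z ∂(rhoInf S c) := by
  let u₀ : Vel d := ⟨EuclideanSpace.single ⟨0, by omega⟩ 1, by simp⟩
  obtain ⟨C, hC0, hC⟩ := exists_integral_rhoInf hS hc u₀
  have hgφ : ∀ t, Continuous fun z => g (φ t z) := fun t => hg.continuous.comp (hφ.continuous' hS t)
  let w : ℝ → Conf d × Conf d → ℝ := fun t z =>
    (c * radialWeight ‖z.2‖ * g (φ t (z.1, radial u₀ z.2))) * Real.exp (-S z.1)
  let F : ℝ → ℝ := fun t => ∫ z, w t z ∂(volume.prod volume)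
  have hF : ∀ t, F t = C * ∫ z, g (φ t z) ∂(rhoInf S c) := fun t =>
    hC (fun z => g (φ t z)) (hgφ t).stronglyMeasurable
  have hM0 : 0 ≤ M := (abs_nonneg _).trans (hgM (0, u₀))
  have hwm : ∀ t, Measurable (w t) := fun t => by
    have h1 : Measurable fun z : Conf d × Conf d => g (φ t (z.1, radial u₀ z.2)) :=
      (hgφ t).measurable.comp (measurable_fst.prodMk ((measurable_radial u₀).comp measurable_snd))
    have h2 : Measurable fun z : Conf d × Conf d => radialWeight ‖z.2‖ :=
      (continuous_radialWeight.comp continuous_snd.norm).measurable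
    have h3 : Measurable fun z : Conf d × Conf d => Real.exp (-S z.1) :=
      (Real.continuous_exp.comp (hS.continuous.comp continuous_fst).neg).measurable
    exact ((h2.const_mul c).mul h1).mul h3
  have hrw : ∀ v : Conf d, |radialWeight ‖v‖| ≤ 2 := fun v => by
    rw [abs_of_nonneg (radialWeight_nonneg (norm_nonneg _)), radialWeight]
    rcases le_total (3 / 2) ‖v‖ with h | h
    · rw [tent_eq_zero (Or.inr h)]; norm_num
    · nlinarith [tent_nonneg ‖v‖, tent_le_one ‖v‖, norm_nonneg v]
  -- dominating functions, supported on the positions with `|x| ≤ R'`; in time `t` the support of `g`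
  -- is reached only from positions with `|x| ≤ R + |t|`
  let bound : ℝ → ℝ → Conf d × Conf d → ℝ := fun R' A =>
    (Metric.closedBall 0 R' ×ˢ Metric.closedBall 0 2 : Set (Conf d × Conf d)).indicator
      fun z => c * 2 * A * Real.exp (-S z.1)
  have hbound : ∀ R' A, Integrable (bound R' A) (volume.prod volume) := fun R' A => by
    have hK : IsCompact (Metric.closedBall 0 R' ×ˢ Metric.closedBall 0 2 : Set (Conf d × Conf d)) :=
      (isCompact_closedBall _ _).prod (isCompact_closedBall _ _)
    rw [integrable_indicator_iff hK.measurableSet]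
    refine ContinuousOn.integrableOn_compact hK (Continuous.continuousOn ?_)
    exact continuous_const.mul (Real.continuous_exp.comp (hS.continuous.comp continuous_fst).neg)
  have hle : ∀ (a : Phase d → ℝ) (R' A : ℝ), 0 ≤ A → (∀ y, |a y| ≤ A) →
      (∀ y, R' < ‖y.1‖ → a y = 0) → ∀ z : Conf d × Conf d,
      ‖(c * radialWeight ‖z.2‖ * a (z.1, radial u₀ z.2)) * Real.exp (-S z.1)‖ ≤ bound R' A z := by
    intro a R' A hA ha ha0 z
    by_cases hz : z ∈ (Metric.closedBall 0 R' ×ˢ Metric.closedBall 0 2 : Set (Conf d × Conf d))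
    · simp only [bound, Set.indicator_of_mem hz, norm_mul, Real.norm_eq_abs, Real.abs_exp,
        abs_of_pos hc]
      gcongr
      · exact hrw _
      · exact ha _
    · simp only [bound, Set.indicator_of_notMem hz]
      by_cases h1 : z.1 ∈ Metric.closedBall (0 : Conf d) R'
      · have h2 : z.2 ∉ Metric.closedBall (0 : Conf d) 2 := fun h2 => hz ⟨h1, h2⟩
        have h3 : 2 < ‖z.2‖ := by simpa using h2
        simp [radialWeight, tent_eq_zero (Or.inr (by linarith : 3 / 2 ≤ ‖z.2‖))]
      · have h3 : R' < ‖z.1‖ := by simpa using h1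
        simp [ha0 (z.1, radial u₀ z.2) h3]
  have hwi : ∀ t, Integrable (w t) (volume.prod volume) := fun t => by
    refine (hbound (R + |t|) M).mono' (hwm t).aestronglyMeasurable (Eventually.of_forall fun z => ?_)
    refine hle (fun y => g (φ t y)) _ M hM0 (fun y => hgM _) (fun y hy => hgR _ ?_) z
    linarith [hφ.sub_le_norm_fst t y]
  have hderiv : ∀ t, HasDerivAt F 0 t := by
    intro t
    let h : Phase d → ℝ := fun z => g (φ t z)
    have hh0 : ∀ z, R + |t| < ‖z.1‖ → h z = 0 := fun z hz =>
      hgR _ (by linarith [hφ.sub_le_norm_fst t z])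
    obtain ⟨B, hB⟩ := hφ.exists_lipschitzOnWith' hS (R + |t| + 1) t
    obtain ⟨D, hD⟩ := exists_lipschitzWith_rayExtension u₀ hh0 (fun z => hgM _)
      (hg.comp_lipschitzOnWith hB)
    have hcs := hasCompactSupport_rayExtension u₀ hh0
    have hzero := integral_fderiv_field_eq_zero hd hS hD hcs
    obtain ⟨V, hV0, hV⟩ := hφ.exists_dist_le hS (R + |t| + 1) t
    rw [hasDerivAt_iff_tendsto_slope_zero]
    have hlim : Tendsto (fun s : ℝ => ∫ z, s⁻¹ • (w (t + s) z - w t z) ∂(volume.prod volume))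
        (𝓝[≠] 0) (𝓝 (∫ z, c * (Real.exp (-S z.1) * fderiv ℝ (rayExtension u₀ h) z (field S z))
          ∂(volume.prod volume))) := by
      refine tendsto_integral_filter_of_dominated_convergence (bound (R + |t| + 1) (L * V))
        (Eventually.of_forall fun s =>
          (((hwm (t + s)).sub (hwm t)).const_smul s⁻¹).aestronglyMeasurable) ?_ (hbound _ _) ?_
      · have hs1 : ∀ᶠ s : ℝ in 𝓝[≠] 0, |s| < 1 :=
          (continuous_abs.tendsto' 0 0 abs_zero).eventually (gt_mem_nhds one_pos)
            |>.filter_mono nhdsWithin_le_nhds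
        filter_upwards [hs1, self_mem_nhdsWithin] with s hs hs0
        refine Eventually.of_forall fun z => ?_
        have hsp : 0 < |s| := abs_pos.2 hs0
        have := hle (fun y => s⁻¹ * (g (φ (t + s) y) - g (φ t y))) (R + |t| + 1) (L * V)
          (by positivity) (fun y => ?_) (fun y hy => ?_) z
        · refine le_of_eq_of_le (congrArg norm ?_) this
          simp only [w, smul_eq_mul]
          ring
        · rw [abs_mul, abs_inv]
          by_cases hy : ‖y.1‖ ≤ R + |t| + 1
          · have h1 : |g (φ (t + s) y) - g (φ t y)| ≤ L * (V * |s|) := by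
              rw [← Real.dist_eq]
              exact (hg.dist_le_mul _ _).trans (by gcongr; exact hV y hy s hs.le)
            calc |s|⁻¹ * |g (φ (t + s) y) - g (φ t y)| ≤ |s|⁻¹ * (L * (V * |s|)) := by gcongr
              _ = L * V := by field_simp
          · have h2 := abs_add_le t s
            rw [hgR _ (by linarith [hφ.sub_le_norm_fst (t + s) y, not_le.1 hy]),
              hgR _ (by linarith [hφ.sub_le_norm_fst t y, not_le.1 hy])]
            simp only [sub_self, abs_zero, mul_zero]
            positivity
        · have h2 := abs_add_le t s
          rw [hgR _ (by linarith [hφ.sub_le_norm_fst (t + s) y]),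
            hgR _ (by linarith [hφ.sub_le_norm_fst t y]), sub_self, mul_zero]
      · filter_upwards [hD.ae_differentiableAt] with z hz
        have h1 := hφ.hasDerivAt_rayExtension u₀ hz
        rw [hasDerivAt_iff_tendsto_slope_zero] at h1
        have h2 := (h1.const_mul (Real.exp (-S z.1))).const_mul c
        refine h2.congr fun s => ?_
        simp only [w, h, zero_add, smul_eq_mul, hφ.add hS t s, hφ.init]
        ring
    rw [integral_const_mul, hzero, mul_zero] at hlim
    refine hlim.congr fun s => ?_
    rw [integral_smul, integral_sub (hwi _) (hwi _)]
  have hconst := is_const_of_deriv_eq_zero (fun t => (hderiv t).differentiableAt)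
    (fun t => (hderiv t).deriv) t 0
  rw [hF, hF] at hconst
  simpa [hφ.init] using mul_left_cancel₀ hC0 hconst

lemma isLocallyFiniteMeasure_rhoInf (hS : ContDiff ℝ 2 S) (c : ℝ) :
    IsLocallyFiniteMeasure (rhoInf S c) := by
  have : IsLocallyFiniteMeasure ((volume : Measure (Conf d)).withDensity
      fun x => ENNReal.ofReal (c * Real.exp (-S x))) := by
    have hS' := hS.continuous
    exact IsLocallyFiniteMeasure.withDensity_ofReal (by fun_prop)
  unfold rhoInf
  infer_instance

theorem IsFlow.map_rhoInf (hφ : IsFlow S φ) (hd : 2 ≤ d) (hS : ContDiff ℝ 2 S) {c : ℝ}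
    (hc : 0 < c) (t : ℝ) : (rhoInf S c).map (φ t) = rhoInf S c := by
  have hlf := isLocallyFiniteMeasure_rhoInf hS c
  let Θ : Phase d ≃ₜ Phase d :=
    { toFun := φ t
      invFun := φ (-t)
      left_inv := fun z => by rw [← hφ.add hS, neg_add_cancel, hφ.init]
      right_inv := fun z => by rw [← hφ.add hS, add_neg_cancel, hφ.init]
      continuous_toFun := hφ.continuous' hS t
      continuous_invFun := hφ.continuous' hS (-t) }
  have hreg : ((rhoInf S c).map (φ t)).Regular := Measure.Regular.map Θ
  -- it suffices to compare the measures on compact sets, whose indicators are limits of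
  -- compactly supported Lipschitz functions
  apply Measure.OuterRegular.ext_isOpen
  apply Measure.InnerRegularWRT.eq_of_innerRegularWRT_of_forall_eq Measure.Regular.innerRegular
    Measure.Regular.innerRegular
  intro K hK
  rw [Measure.map_apply (hφ.continuous' hS t).measurable hK.measurableSet]
  rcases K.eq_empty_or_nonempty with rfl | hKne
  · simp
  obtain ⟨R, hR⟩ := (hK.image continuous_fst).isBounded.exists_norm_le
  let g : ℕ → Phase d → ℝ := fun n z => max 0 (1 - n * Metric.infDist z K)
  have hgL : ∀ n : ℕ, LipschitzWith n (g n) := fun n => by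
    refine LipschitzWith.const_max (LipschitzWith.of_dist_le_mul fun y z => ?_) 0
    have := (Metric.lipschitz_infDist_pt K).dist_le_mul y z
    rw [Real.dist_eq] at this ⊢
    have h2 : 1 - n * Metric.infDist y K - (1 - n * Metric.infDist z K) =
      -(n * (Metric.infDist y K - Metric.infDist z K)) := by ring
    rw [h2, abs_neg, abs_mul, Nat.abs_cast]
    simp only [NNReal.coe_one, one_mul, NNReal.coe_natCast] at this ⊢
    gcongr
  have hg01 : ∀ n z, 0 ≤ g n z ∧ g n z ≤ 1 := fun n z =>
    ⟨le_max_left _ _, max_le zero_le_one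
      (by have := mul_nonneg (Nat.cast_nonneg (α := ℝ) n) (Metric.infDist_nonneg (x := z) (s := K))
          linarith)⟩
  have hgabs : ∀ n z, |g n z| ≤ 1 := fun n z => by
    rw [abs_of_nonneg (hg01 n z).1]; exact (hg01 n z).2
  have hg0 : ∀ n, 1 ≤ n → ∀ z : Phase d, R + 1 < ‖z.1‖ → g n z = 0 := fun n hn z hz => by
    refine max_eq_left ?_
    have h1 : 1 ≤ Metric.infDist z K := by
      rw [Metric.le_infDist hKne]
      intro y hy
      have h2 := hR y.1 (Set.mem_image_of_mem _ hy)
      have h3 := norm_sub_norm_le z.1 y.1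
      rw [← dist_eq_norm] at h3
      have h4 : dist z.1 y.1 ≤ dist z y := le_max_left _ _
      linarith
    have h2 : (1 : ℝ) ≤ n := by exact_mod_cast hn
    nlinarith
  have hglim : ∀ z, Tendsto (fun n => g n z) atTop (𝓝 (K.indicator 1 z)) := fun z => by
    by_cases hz : z ∈ K
    · have : ∀ n, g n z = 1 := fun n => by
        simp [g, Metric.infDist_zero_of_mem hz]
      simp only [this, Set.indicator_of_mem hz, Pi.one_apply]
      exact tendsto_const_nhds
    · have hpos : 0 < Metric.infDist z K :=
        (hK.isClosed.notMem_iff_infDist_pos hKne).1 hz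
      rw [Set.indicator_of_notMem hz]
      refine tendsto_const_nhds.congr' ?_
      obtain ⟨N, hN⟩ := exists_nat_ge (1 / Metric.infDist z K)
      filter_upwards [eventually_ge_atTop N] with n hn
      symm
      refine max_eq_left ?_
      have : 1 / Metric.infDist z K ≤ n := hN.trans (by exact_mod_cast hn)
      rw [div_le_iff₀ hpos] at this
      linarith
  have key : ∀ s : ℝ, Tendsto (fun n => ∫ z, g n (φ s z) ∂(rhoInf S c)) atTop
      (𝓝 ((rhoInf S c).real (φ s ⁻¹' K))) := fun s => by
    have hKm : MeasurableSet (φ s ⁻¹' K) := (hφ.continuous' hS s).measurable hK.measurableSet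
    rw [← integral_indicator_one hKm]
    let K' : Set (Phase d) := Metric.closedBall 0 (R + 1 + |s|) ×ˢ Set.univ
    have hK' : IsCompact K' := (isCompact_closedBall _ _).prod isCompact_univ
    refine tendsto_integral_filter_of_dominated_convergence (K'.indicator 1)
      (Eventually.of_forall fun n =>
        ((hgL n).continuous.comp (hφ.continuous' hS s)).aestronglyMeasurable) ?_ ?_ ?_
    · filter_upwards [eventually_ge_atTop 1] with n hn
      refine Eventually.of_forall fun z => ?_
      by_cases hz : z ∈ K'
      · rw [Set.indicator_of_mem hz]
        exact hgabs _ _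
      · rw [Set.indicator_of_notMem hz, hg0 n hn, norm_zero]
        have : R + 1 + |s| < ‖z.1‖ := by
          by_contra hcon
          exact hz ⟨by simpa using not_lt.1 hcon, trivial⟩
        linarith [hφ.sub_le_norm_fst s z]
    · rw [integrable_indicator_iff hK'.measurableSet]
      exact continuousOn_const.integrableOn_compact hK'
    · exact Eventually.of_forall fun z => hglim _
  have heq : ∀ᶠ n in atTop, ∫ z, g n (φ t z) ∂(rhoInf S c) = ∫ z, g n (φ 0 z) ∂(rhoInf S c) := by
    filter_upwards [eventually_ge_atTop 1] with n hn
    rw [hφ.integral_comp_eq hd hS hc (hgL n) (hgabs n) (hg0 n hn) t]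
    simp only [hφ.init]
  have h := tendsto_nhds_unique ((key t).congr' heq) (key 0)
  have h0 : φ 0 ⁻¹' K = K := by ext z; simp [hφ.init]
  rw [h0] at h
  have hfin : (rhoInf S c) (φ t ⁻¹' K) ≠ ⊤ :=
    ((Θ.isCompact_preimage).2 hK).measure_lt_top.ne
  exact (measureReal_eq_measureReal_iff hfin hK.measure_lt_top.ne).1 h

end Liouville

section SphereLaplacian

variable {d : ℕ}

/-! ### The Laplace-Beltrami operator -/

section Laplacian

variable {E : Type*} [NormedAddCommGroup E] [InnerProductSpace ℝ E]

lemma hasDerivAt_add_smul (x e : E) (s : ℝ) : HasDerivAt (fun s : ℝ => x + s • e) e s := by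
  simpa using ((hasDerivAt_id s).smul_const e).const_add x

/-- The second derivative along a line. -/
lemma iteratedFDeriv_two_eq_deriv_deriv {H : E → ℝ} {x : E} (hH : ContDiffAt ℝ 2 H x) (e : E) :
    iteratedFDeriv ℝ 2 H x ![e, e] = deriv (deriv fun s : ℝ => H (x + s • e)) 0 := by
  have hev : ∀ᶠ y in 𝓝 x, DifferentiableAt ℝ H y :=
    (hH.eventually (by simp)).mono fun y hy => hy.differentiableAt (by norm_num)
  have hcont : Tendsto (fun s : ℝ => x + s • e) (𝓝 0) (𝓝 x) := by
    have := (hasDerivAt_add_smul x e 0).continuousAt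
    simpa [ContinuousAt] using this
  have h1 : deriv (fun s : ℝ => H (x + s • e)) =ᶠ[𝓝 0] fun s => fderiv ℝ H (x + s • e) e := by
    filter_upwards [hcont.eventually hev] with s hs
    exact (hs.hasFDerivAt.comp_hasDerivAt s (hasDerivAt_add_smul x e s)).deriv
  have h2 : DifferentiableAt ℝ (fderiv ℝ H) (x + (0 : ℝ) • e) := by
    rw [zero_smul, add_zero]
    exact (hH.fderiv_right (m := 1) (by norm_num)).differentiableAt one_ne_zero
  have h3 := h2.hasFDerivAt.comp_hasDerivAt 0 (hasDerivAt_add_smul x e 0)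
  have h4 := h3.clm_apply (hasDerivAt_const (0 : ℝ) e)
  rw [h1.deriv_eq, iteratedFDeriv_two_apply]
  have h5 : deriv (fun s : ℝ => fderiv ℝ H (x + s • e) e) 0 = _ := h4.deriv
  rw [h5]
  simp

lemma laplacian_eq_sum_deriv_deriv {ι : Type*} [Fintype ι] [FiniteDimensional ℝ E]
    (b : OrthonormalBasis ι ℝ E) {H : E → ℝ} {x : E} (hH : ContDiffAt ℝ 2 H x) :
    Laplacian.laplacian H x = ∑ i, deriv (deriv fun s : ℝ => H (x + s • b i)) 0 := by
  rw [InnerProductSpace.laplacian_eq_iteratedFDeriv_orthonormalBasis H b]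
  exact Finset.sum_congr rfl fun i _ => iteratedFDeriv_two_eq_deriv_deriv hH (b i)

lemma deriv_deriv_nonpos_of_isLocalMax {f : ℝ → ℝ} {x : ℝ} (hf : IsLocalMax f x)
    (hc : ContinuousAt f x) : deriv (deriv f) x ≤ 0 := by
  by_contra! h
  have hmin := isLocalMin_of_deriv_deriv_pos h hf.deriv_eq_zero hc
  have hconst : f =ᶠ[𝓝 x] fun _ => f x := by
    filter_upwards [hf, hmin] with y h1 h2 using le_antisymm h1 h2
  have : deriv (deriv f) x = 0 := by
    rw [hconst.deriv.deriv_eq]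
    simp
  linarith

lemma laplacian_nonpos_of_isLocalMax [FiniteDimensional ℝ E] {H : E → ℝ} {x : E}
    (hH : ContDiffAt ℝ 2 H x) (hmax : IsLocalMax H x) : Laplacian.laplacian H x ≤ 0 := by
  rw [laplacian_eq_sum_deriv_deriv (stdOrthonormalBasis ℝ E) hH]
  refine Finset.sum_nonpos fun i _ => ?_
  set e := stdOrthonormalBasis ℝ E i
  have hcont : ContinuousAt (fun s : ℝ => x + s • e) 0 := (hasDerivAt_add_smul x e 0).continuousAt
  have hx : x + (0 : ℝ) • e = x := by simp
  have hHc : ContinuousAt H (x + (0 : ℝ) • e) := by rw [hx]; exact hH.continuousAt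
  refine deriv_deriv_nonpos_of_isLocalMax ?_ (ContinuousAt.comp (f := fun s : ℝ => x + s • e) hHc hcont)
  have : Tendsto (fun s : ℝ => x + s • e) (𝓝 0) (𝓝 x) := by
    simpa [ContinuousAt] using hcont
  filter_upwards [this.eventually hmax] with s hs
  simpa using hs

end Laplacian

/-- The extension of the restriction of `G` to the sphere which is constant along rays. -/
noncomputable def degreeZero (G : Conf d → ℝ) (x : Conf d) : ℝ := G (‖x‖⁻¹ • x)

lemma contDiffAt_degreeZero {G : Conf d → ℝ} {n : ℕ∞ω} (hG : ContDiff ℝ n G) {x : Conf d}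
    (hx : x ≠ 0) : ContDiffAt ℝ n (degreeZero G) x :=
  hG.contDiffAt.comp x
    (((contDiffAt_norm ℝ hx).inv (norm_ne_zero_iff.2 hx)).smul contDiffAt_id)

lemma sphereLaplacian_eq (G : Conf d → ℝ) (u : Vel d) :
    sphereLaplacian G u = Laplacian.laplacian (degreeZero G) (u : Conf d) := rfl

/-- The Laplacian depends only on the restriction of the function to the sphere. -/
lemma sphereLaplacian_congr {G G' : Conf d → ℝ} (h : ∀ u : Vel d, G u = G' u) (u : Vel d) :
    sphereLaplacian G u = sphereLaplacian G' u := by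
  refine InnerProductSpace.laplacian_congr_nhds ?_ |>.eq_of_nhds
  have : ∀ᶠ x in 𝓝 (u : Conf d), x ≠ 0 := isOpen_ne.mem_nhds (ne_zero_of_mem_unit_sphere u)
  filter_upwards [this] with x hx
  exact h ⟨‖x‖⁻¹ • x, by simp [norm_smul, hx]⟩

lemma sphereLaplacian_sub {G G' : Conf d → ℝ} (hG : ContDiff ℝ 2 G) (hG' : ContDiff ℝ 2 G')
    (u : Vel d) :
    sphereLaplacian (fun x => G x - G' x) u = sphereLaplacian G u - sphereLaplacian G' u :=
  (contDiffAt_degreeZero hG (ne_zero_of_mem_unit_sphere u)).laplacian_sub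
    (contDiffAt_degreeZero hG' (ne_zero_of_mem_unit_sphere u))

lemma continuous_sphereLaplacian {G : Conf d → ℝ} (hG : ContDiff ℝ 2 G) :
    Continuous (sphereLaplacian G) := by
  rw [continuous_iff_continuousAt]
  intro u
  have h : ContinuousAt (Laplacian.laplacian (degreeZero G)) (u : Conf d) := by
    rw [InnerProductSpace.laplacian_eq_iteratedFDeriv_stdOrthonormalBasis]
    have h2 : ContinuousAt (iteratedFDeriv ℝ 2 (degreeZero G)) (u : Conf d) :=
      ((contDiffAt_degreeZero hG (ne_zero_of_mem_unit_sphere u)).iteratedFDeriv_right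
        (m := 0) (i := 2) (by norm_num)).continuousAt
    refine tendsto_finsetSum _ fun i _ => ?_
    exact ((ContinuousMultilinearMap.apply ℝ (fun _ : Fin 2 => Conf d) ℝ
      ![stdOrthonormalBasis ℝ (Conf d) i, stdOrthonormalBasis ℝ (Conf d) i]).continuous.tendsto _).comp h2
  exact h.comp continuousAt_subtype_val

/-- The maximum principle: a maximum on the sphere is a local maximum of the extension. -/
lemma sphereLaplacian_nonpos {G : Conf d → ℝ} (hG : ContDiff ℝ 2 G) {u : Vel d}
    (hu : ∀ v : Vel d, G v ≤ G u) : sphereLaplacian G u ≤ 0 := by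
  refine laplacian_nonpos_of_isLocalMax (contDiffAt_degreeZero hG (ne_zero_of_mem_unit_sphere u)) ?_
  have : ∀ᶠ x in 𝓝 (u : Conf d), x ≠ 0 := isOpen_ne.mem_nhds (ne_zero_of_mem_unit_sphere u)
  filter_upwards [this] with x hx
  have := hu ⟨‖x‖⁻¹ • x, by simp [norm_smul, hx]⟩
  simpa [degreeZero] using this

/-! ### The Laplace-Beltrami operator on polynomials -/

open MvPolynomial in
/-- A polynomial as a function on `ℝ^d`. -/
noncomputable def polyFun (p : MvPolynomial (Fin d) ℝ) (x : Conf d) : ℝ := eval x.ofLp p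

open MvPolynomial in
/-- The action of the Laplace-Beltrami operator on polynomials. Factors `|x|²`, which are one on the
sphere, are inserted so that the operator preserves the homogeneous components:
`∑ j k, (Xₖ² ∂ⱼ² p - Xₖ Xⱼ ∂ₖ ∂ⱼ p) - (d - 1) ∑ j, Xⱼ ∂ⱼ p`. -/
noncomputable def polyLaplacian : MvPolynomial (Fin d) ℝ →ₗ[ℝ] MvPolynomial (Fin d) ℝ where
  toFun p := ∑ j, ∑ k, (X k * X k * pderiv j (pderiv j p) - X k * X j * pderiv k (pderiv j p))
    - ((d : ℝ) - 1) • ∑ j, X j * pderiv j p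
  map_add' p q := by
    simp only [map_add, mul_add, Finset.sum_add_distrib, Finset.sum_sub_distrib, smul_add]
    abel
  map_smul' c p := by
    simp only [Derivation.map_smul, mul_smul_comm, ← Finset.smul_sum, ← smul_sub, RingHom.id_apply]
    rw [smul_sub, smul_comm c ((d : ℝ) - 1)]

lemma polyLaplacian_apply (p : MvPolynomial (Fin d) ℝ) :
    polyLaplacian p = ∑ j, ∑ k, (MvPolynomial.X k * MvPolynomial.X k *
      MvPolynomial.pderiv j (MvPolynomial.pderiv j p) - MvPolynomial.X k * MvPolynomial.X j *
      MvPolynomial.pderiv k (MvPolynomial.pderiv j p))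
    - ((d : ℝ) - 1) • ∑ j, MvPolynomial.X j * MvPolynomial.pderiv j p := rfl

lemma hasDerivAt_polyFun (p : MvPolynomial (Fin d) ℝ) {w : ℝ → Conf d} {w' : Fin d → ℝ} {s : ℝ}
    (hw : ∀ j, HasDerivAt (fun s => w s j) (w' j) s) :
    HasDerivAt (fun s => polyFun p (w s)) (∑ j, polyFun (MvPolynomial.pderiv j p) (w s) * w' j) s := by
  induction p using MvPolynomial.induction_on with
  | C a => simpa [polyFun] using hasDerivAt_const s a
  | add p q hp hq =>
    simp only [polyFun, map_add, add_mul, Finset.sum_add_distrib] at hp hq ⊢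
    exact hp.add hq
  | mul_X p i hp =>
    have h : (fun s => polyFun (p * MvPolynomial.X i) (w s)) = fun s => polyFun p (w s) * w s i := by
      ext s; simp [polyFun]
    rw [h]
    refine (hp.mul (hw i)).congr_deriv ?_
    simp only [polyFun, MvPolynomial.pderiv_mul, map_add, map_mul, MvPolynomial.eval_X, add_mul,
      Finset.sum_add_distrib, Finset.sum_mul, MvPolynomial.pderiv_X]
    congr 1
    · exact Finset.sum_congr rfl fun j _ => by ring
    · rw [Finset.sum_eq_single i]
      · simp
      · intro j _ hj
        simp [hj.symm]
      · simp

lemma contDiff_polyFun (p : MvPolynomial (Fin d) ℝ) {n : ℕ∞ω} : ContDiff ℝ n (polyFun p) := by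
  induction p using MvPolynomial.induction_on with
  | C a =>
    have : polyFun (MvPolynomial.C a : MvPolynomial (Fin d) ℝ) = fun _ => a := by
      ext; simp [polyFun]
    rw [this]
    exact contDiff_const
  | add p q hp hq =>
    have : polyFun (p + q) = fun x => polyFun p x + polyFun q x := by ext; simp [polyFun]
    rw [this]
    exact hp.add hq
  | mul_X p i hp =>
    have : polyFun (p * MvPolynomial.X i) = fun x => polyFun p x * x i := by ext; simp [polyFun]
    rw [this]
    exact hp.mul (EuclideanSpace.proj i : Conf d →L[ℝ] ℝ).contDiff

lemma deriv_deriv_polyFun (p : MvPolynomial (Fin d) ℝ) {w : ℝ → Conf d} {w₁ : Fin d → ℝ → ℝ}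
    {w₂ : Fin d → ℝ} (hw : ∀ᶠ s in 𝓝 0, ∀ j, HasDerivAt (fun s => w s j) (w₁ j s) s)
    (hw₁ : ∀ j, HasDerivAt (w₁ j) (w₂ j) 0) :
    deriv (deriv fun s => polyFun p (w s)) 0 =
      ∑ j, ((∑ k, polyFun (MvPolynomial.pderiv k (MvPolynomial.pderiv j p)) (w 0) * w₁ k 0) * w₁ j 0
        + polyFun (MvPolynomial.pderiv j p) (w 0) * w₂ j) := by
  have h1 : deriv (fun s => polyFun p (w s)) =ᶠ[𝓝 0]
      fun s => ∑ j, polyFun (MvPolynomial.pderiv j p) (w s) * w₁ j s := by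
    filter_upwards [hw] with s hs using (hasDerivAt_polyFun p hs).deriv
  rw [h1.deriv_eq]
  refine HasDerivAt.deriv (HasDerivAt.fun_sum fun j _ => ?_)
  exact (hasDerivAt_polyFun _ hw.self_of_nhds).mul (hw₁ j)

/-- The first and second derivatives of the normalization along a line through a point of the
sphere. -/
lemma hasDerivAt_normalize (u : Vel d) (e : Conf d) (he : ‖e‖ = 1) :
    ∃ w₁ : Fin d → ℝ → ℝ,
      (∀ᶠ s : ℝ in 𝓝 0, ∀ j, HasDerivAt
        (fun s : ℝ => (‖(u : Conf d) + s • e‖⁻¹ • ((u : Conf d) + s • e)) j) (w₁ j s) s) ∧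
      (∀ j, w₁ j 0 = e j - ⟪(u : Conf d), e⟫ * (u : Conf d) j) ∧
      ∀ j, HasDerivAt (w₁ j) ((3 * ⟪(u : Conf d), e⟫ ^ 2 - 1) * (u : Conf d) j
        - 2 * ⟪(u : Conf d), e⟫ * e j) 0 := by
  set a := ⟪(u : Conf d), e⟫ with ha
  let y : ℝ → Conf d := fun s => (u : Conf d) + s • e
  let r : ℝ → ℝ := fun s => ‖y s‖⁻¹
  have hy : ∀ s, HasDerivAt y e s := fun s => hasDerivAt_add_smul _ e s
  have hyj : ∀ j s, HasDerivAt (fun s => y s j) (e j) s := fun j s => by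
    have := (hasDerivAt_id s).mul_const (e j) |>.const_add ((u : Conf d) j)
    simpa [y] using this
  have hin : ∀ s, ⟪y s, e⟫ = a + s := fun s => by
    simp [y, inner_add_left, inner_smul_left, he, ha]
  have hy0 : y 0 = u := by simp [y]
  have hr : ∀ s, y s ≠ 0 → HasDerivAt r (-(a + s) * r s ^ 3) s := fun s hs => by
    have hpos : 0 < ‖y s‖ := norm_pos_iff.2 hs
    have h1 := (((hy s).norm_sq).sqrt (by positivity)).inv (by
      rw [Real.sqrt_sq hpos.le]; exact hpos.ne')
    have h2 : r = fun s => (√(‖y s‖ ^ 2))⁻¹ := by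
      ext s; simp [r, Real.sqrt_sq (norm_nonneg _)]
    have h3 : r s = ‖y s‖⁻¹ := rfl
    rw [h3, h2]
    refine h1.congr_deriv ?_
    simp only [hin, Real.sqrt_sq hpos.le]
    field_simp
  have hr0 : r 0 = 1 := by simp [r, hy0]
  have hne : ∀ᶠ s in 𝓝 0, y s ≠ 0 := by
    have h0 : y 0 ≠ 0 := by rw [hy0]; exact ne_zero_of_mem_unit_sphere u
    exact (hy 0).continuousAt.eventually_ne h0
  refine ⟨fun j s => (-(a + s) * r s ^ 3) * y s j + r s * e j, ?_, fun j => ?_, fun j => ?_⟩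
  · filter_upwards [hne] with s hs j
    exact (hr s hs).mul (hyj j s)
  · simp [hr0, hy0]
    ring
  · have hr' : HasDerivAt r (-a) 0 := by
      have := hr 0 hne.self_of_nhds
      simpa [hr0] using this
    have h1 : HasDerivAt (fun s => -(a + s)) (-1) 0 := ((hasDerivAt_id (0 : ℝ)).const_add a).neg
    have h2 := ((h1.mul (hr'.pow 3)).mul (hyj j 0)).add (hr'.mul_const (e j))
    refine h2.congr_deriv ?_
    simp only [hr0, hy0]
    simp [hr0]
    ring

lemma sum_sq_vel (u : Vel d) : ∑ i, (u : Conf d) i * (u : Conf d) i = 1 := by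
  have h := norm_vel u
  rw [EuclideanSpace.norm_eq, Real.sqrt_eq_one] at h
  simpa [sq] using h

/-- The Laplacian of the restriction of a polynomial to the sphere, from the first and second
derivatives of `s ↦ p ((u + s e) / |u + s e|)` for the vectors `e` of the standard basis. -/
lemma sphereLaplacian_polyFun (p : MvPolynomial (Fin d) ℝ) (u : Vel d) :
    sphereLaplacian (polyFun p) u = polyFun (polyLaplacian p) u := by
  have hx0 : (u : Conf d) ≠ 0 := ne_zero_of_mem_unit_sphere u
  rw [sphereLaplacian_eq, laplacian_eq_sum_deriv_deriv (EuclideanSpace.basisFun (Fin d) ℝ)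
    (contDiffAt_degreeZero (contDiff_polyFun p) hx0)]
  set x := (u : Conf d) with hx
  set P₂ : Fin d → Fin d → ℝ := fun k j =>
    polyFun (MvPolynomial.pderiv k (MvPolynomial.pderiv j p)) x with hP₂
  set P₁ : Fin d → ℝ := fun j => polyFun (MvPolynomial.pderiv j p) x with hP₁
  have hterm : ∀ i, deriv (deriv fun s : ℝ =>
      degreeZero (polyFun p) (x + s • EuclideanSpace.basisFun (Fin d) ℝ i)) 0 =
      ∑ j, ((∑ k, P₂ k j * ((if k = i then 1 else 0) - x i * x k)) *
        ((if j = i then 1 else 0) - x i * x j)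
        + P₁ j * ((3 * x i ^ 2 - 1) * x j - 2 * x i * (if j = i then 1 else 0))) := by
    intro i
    set e : Conf d := EuclideanSpace.basisFun (Fin d) ℝ i with he
    have he1 : ‖e‖ = 1 := (EuclideanSpace.basisFun (Fin d) ℝ).norm_eq_one i
    have hej : ∀ j, e j = if j = i then 1 else 0 := fun j => by simp [he]
    have hin : ⟪x, e⟫ = x i := by simp [he, EuclideanSpace.inner_single_right]
    obtain ⟨w₁, h1, h2, h3⟩ := hasDerivAt_normalize u e he1
    have := deriv_deriv_polyFun p (w := fun s => ‖x + s • e‖⁻¹ • (x + s • e)) h1 h3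
    have h0 : ‖x + (0 : ℝ) • e‖⁻¹ • (x + (0 : ℝ) • e) = x := by simp [hx]
    rw [h0] at this
    simp only [h2, ← hx, hin, hej] at this
    exact this
  simp_rw [hterm]
  have hRHS : polyFun (polyLaplacian p) x =
      ∑ j, ∑ k, (x k * x k * P₂ j j - x k * x j * P₂ k j) - ((d : ℝ) - 1) * ∑ j, x j * P₁ j := by
    simp [polyFun, polyLaplacian_apply, hP₂, hP₁, MvPolynomial.smul_eval]
  have hu := sum_sq_vel u
  rw [← hx] at hu
  rw [hRHS]
  simp_rw [Finset.sum_add_distrib]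
  -- summed over the basis, the second derivatives give `∑ j, P₂ j j - ∑ j k, xⱼ xₖ P₂ k j`
  have hA : ∑ i, ∑ j, (∑ k, P₂ k j * ((if k = i then 1 else 0) - x i * x k)) *
        ((if j = i then 1 else 0) - x i * x j) =
      ∑ j, ∑ k, (x k * x k * P₂ j j - x k * x j * P₂ k j) := by
    rw [Finset.sum_comm]
    refine Finset.sum_congr rfl fun j _ => ?_
    have h1 : ∀ i, (∑ k, P₂ k j * ((if k = i then 1 else 0) - x i * x k)) *
        ((if j = i then 1 else 0) - x i * x j) =
        (if j = i then P₂ i j - x i * ∑ k, x k * P₂ k j else 0)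
        - x i * x j * P₂ i j + (x i * x i) * (x j * ∑ k, x k * P₂ k j) := by
      intro i
      have : ∑ k, P₂ k j * ((if k = i then 1 else 0) - x i * x k) =
          P₂ i j - x i * ∑ k, x k * P₂ k j := by
        simp only [mul_sub, Finset.sum_sub_distrib, mul_ite, mul_one, mul_zero,
          Finset.sum_ite_eq', Finset.mem_univ, if_true, Finset.mul_sum]
        congr 1
        exact Finset.sum_congr rfl fun k _ => by ring
      rw [this]
      split_ifs <;> ring
    simp_rw [h1, Finset.sum_add_distrib, Finset.sum_sub_distrib, ← Finset.sum_mul, hu]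
    simp
    ring
  have hB : ∑ i, ∑ j, P₁ j * ((3 * x i ^ 2 - 1) * x j - 2 * x i * (if j = i then 1 else 0)) =
      - (((d : ℝ) - 1) * ∑ j, x j * P₁ j) := by
    rw [Finset.sum_comm, Finset.mul_sum, ← Finset.sum_neg_distrib]
    refine Finset.sum_congr rfl fun j _ => ?_
    have h1 : ∀ i, P₁ j * ((3 * x i ^ 2 - 1) * x j - 2 * x i * (if j = i then 1 else 0)) =
        (x i * x i) * (3 * x j * P₁ j) - x j * P₁ j - (if j = i then 2 * x i * P₁ j else 0) := by
      intro i
      split_ifs <;> ring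
    simp_rw [h1, Finset.sum_sub_distrib, ← Finset.sum_mul, hu]
    simp
    ring
  rw [hA, hB]
  ring

end SphereLaplacian

section MeanZero

variable {d : ℕ}

/-! ### The Laplacian of a polynomial has mean zero -/

section Degree

open MvPolynomial

lemma isHomogeneous_X_mul_pderiv {p : MvPolynomial (Fin d) ℝ} {n : ℕ} (hp : p.IsHomogeneous n)
    (k j : Fin d) : (X k * pderiv j p).IsHomogeneous n := by
  rcases n with _ | n
  · rw [← totalDegree_zero_iff_isHomogeneous, totalDegree_eq_zero_iff_eq_C] at hp
    rw [hp, pderiv_C, mul_zero]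
    exact isHomogeneous_zero _ _ _
  · rw [add_comm]
    exact (isHomogeneous_X ℝ k).mul hp.pderiv

/-- The second order operators are compositions of the first order operators `Xₖ ∂ᵢ`, up to lower
order terms; this avoids subtracting degrees. -/
lemma isHomogeneous_X_mul_X_mul_pderiv {p : MvPolynomial (Fin d) ℝ} {n : ℕ}
    (hp : p.IsHomogeneous n) (k l i j : Fin d) :
    (X k * X l * pderiv i (pderiv j p)).IsHomogeneous n := by
  have h : X k * X l * pderiv i (pderiv j p) =
      X k * pderiv i (X l * pderiv j p) - C (Pi.single (M := fun _ => ℝ) i 1 l) * (X k * pderiv j p) := by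
    rw [pderiv_mul, pderiv_X]
    by_cases hil : l = i
    · subst hil; simp; ring
    · simp [hil]; ring
  rw [h]
  exact (isHomogeneous_X_mul_pderiv (isHomogeneous_X_mul_pderiv hp l j) k i).sub
    ((isHomogeneous_X_mul_pderiv hp k j).C_mul _)

lemma isHomogeneous_polyLaplacian {p : MvPolynomial (Fin d) ℝ} {n : ℕ} (hp : p.IsHomogeneous n) :
    (polyLaplacian p).IsHomogeneous n := by
  rw [polyLaplacian_apply, smul_eq_C_mul]
  refine IsHomogeneous.sub (IsHomogeneous.sum _ _ _ fun j _ => IsHomogeneous.sum _ _ _ fun k _ => ?_)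
    (IsHomogeneous.C_mul (IsHomogeneous.sum _ _ _ fun j _ => isHomogeneous_X_mul_pderiv hp j j) _)
  exact (isHomogeneous_X_mul_X_mul_pderiv hp k k j j).sub
    (isHomogeneous_X_mul_X_mul_pderiv hp k j k j)

lemma totalDegree_polyLaplacian_le (p : MvPolynomial (Fin d) ℝ) :
    (polyLaplacian p).totalDegree ≤ p.totalDegree := by
  conv_lhs => rw [← sum_homogeneousComponent p, map_sum]
  refine totalDegree_finsetSum_le fun i hi => ?_
  exact (isHomogeneous_polyLaplacian (homogeneousComponent_isHomogeneous i p)).totalDegree_le.trans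
    (Nat.lt_succ_iff.1 (Finset.mem_range.1 hi))

lemma pderiv_pderiv_comm (i k : Fin d) (p : MvPolynomial (Fin d) ℝ) :
    pderiv i (pderiv k p) = pderiv k (pderiv i p) := by
  let D (i : Fin d) : Derivation ℝ (MvPolynomial (Fin d) ℝ) (MvPolynomial (Fin d) ℝ) := pderiv i
  have h0 : ⁅D i, D k⁆ = 0 := by
    refine MvPolynomial.derivation_ext fun j => ?_
    simp only [Derivation.commutator_apply, D, pderiv_X, Derivation.zero_apply]
    rw [Pi.single_apply, Pi.single_apply]
    split_ifs <;> simp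
  have h1 := congrArg (fun D => D p) h0
  simpa [Derivation.commutator_apply, sub_eq_zero, D] using h1

/-- The coordinates of the tangential field whose divergence is the Laplacian of `p`. -/
noncomputable def polyField (p : MvPolynomial (Fin d) ℝ) (i : Fin d) : MvPolynomial (Fin d) ℝ :=
  ∑ k, (X k * X k * pderiv i p - X i * X k * pderiv k p)

lemma sum_pderiv_polyField (p : MvPolynomial (Fin d) ℝ) :
    ∑ i, pderiv i (polyField p i) = polyLaplacian p := by
  have h : ∀ i, pderiv i (polyField p i) =
      ∑ k, (X k * X k * pderiv i (pderiv i p) - X k * X i * pderiv k (pderiv i p))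
        + (X i * pderiv i p - ∑ k, X k * pderiv k p) := by
    intro i
    have h1 : ∀ k, pderiv i (X k * X k * pderiv i p - X i * X k * pderiv k p) =
        (X k * X k * pderiv i (pderiv i p) - X k * X i * pderiv k (pderiv i p))
        + ((if k = i then X i * pderiv i p else 0) - X k * pderiv k p) := by
      intro k
      rw [map_sub]
      simp only [pderiv_mul, pderiv_X, pderiv_pderiv_comm i k p]
      by_cases hk : k = i
      · subst hk; simp
      · simp [hk]; ring
    rw [polyField, map_sum]
    simp_rw [h1, Finset.sum_add_distrib, Finset.sum_sub_distrib]
    simp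
  simp_rw [h, Finset.sum_add_distrib, Finset.sum_sub_distrib]
  rw [polyLaplacian_apply]
  simp only [Finset.sum_sub_distrib, Finset.sum_const, Finset.card_univ, Fintype.card_fin]
  rw [sub_smul, one_smul, Nat.cast_smul_eq_nsmul]
  abel

lemma sum_X_mul_polyField (p : MvPolynomial (Fin d) ℝ) : ∑ i, X i * polyField p i = 0 := by
  simp only [polyField, Finset.mul_sum, mul_sub, Finset.sum_sub_distrib]
  rw [sub_eq_zero]
  rw [Finset.sum_comm]
  refine Finset.sum_congr rfl fun i _ => Finset.sum_congr rfl fun j _ => ?_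
  ring

end Degree

lemma lineDeriv_polyFun (p : MvPolynomial (Fin d) ℝ) (x : Conf d) (i : Fin d) :
    lineDeriv ℝ (polyFun p) x (EuclideanSpace.single i 1) = polyFun (MvPolynomial.pderiv i p) x := by
  have h := hasDerivAt_polyFun p (w := fun s : ℝ => x + s • EuclideanSpace.single i (1 : ℝ))
    (w' := Pi.single i 1) (s := 0) fun j => by
      have := ((hasDerivAt_id (0 : ℝ)).mul_const (EuclideanSpace.single i (1 : ℝ) j)).const_add (x j)
      simpa [Pi.single_apply] using this
  rw [lineDeriv, h.deriv]
  simp [Pi.single_apply]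

lemma polyFun_smul {q : MvPolynomial (Fin d) ℝ} {n : ℕ} (hq : q.IsHomogeneous n) (r : ℝ)
    (x : Conf d) : polyFun q (r • x) = r ^ n * polyFun q x := by
  rw [polyFun, polyFun, MvPolynomial.eval_eq, MvPolynomial.eval_eq, Finset.mul_sum]
  refine Finset.sum_congr rfl fun m hm => ?_
  have hn := hq.degree_eq_sum_deg_support hm
  simp only [PiLp.smul_apply, smul_eq_mul, mul_pow, Finset.prod_mul_distrib]
  rw [Finset.prod_pow_eq_pow_sum, ← hn]
  ring

/-- A smooth radial cutoff. -/
noncomputable def cutoff (r : ℝ) : ℝ := Real.smoothTransition (2 - r ^ 2)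

lemma cutoff_eq_zero {r : ℝ} (hr : 2 ≤ r) : cutoff r = 0 :=
  Real.smoothTransition.zero_of_nonpos (by nlinarith)

lemma cutoff_nonneg (r : ℝ) : 0 ≤ cutoff r := Real.smoothTransition.nonneg _

lemma continuous_cutoff : Continuous cutoff :=
  Real.smoothTransition.continuous.comp (by fun_prop)

lemma hasCompactSupport_cutoff : HasCompactSupport fun x : Conf d => cutoff ‖x‖ :=
  HasCompactSupport.intro (isCompact_closedBall (0 : Conf d) 2) fun v hv =>
    cutoff_eq_zero (by simpa using (lt_of_not_ge (by simpa using hv)).le)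

/-- Integration by parts: the gradient of the radial cutoff is orthogonal to the tangential field
`polyField p`. -/
lemma integral_cutoff_mul_polyLaplacian (p : MvPolynomial (Fin d) ℝ) :
    ∫ x : Conf d, cutoff ‖x‖ * polyFun (polyLaplacian p) x = 0 := by
  have hsm : ContDiff ℝ 1 fun x : Conf d => cutoff ‖x‖ :=
    Real.smoothTransition.contDiff.comp (contDiff_const.sub (contDiff_norm_sq ℝ))
  obtain ⟨D, hD⟩ := hsm.lipschitzWith_of_hasCompactSupport hasCompactSupport_cutoff one_ne_zero
  let e : Fin d → Conf d := fun i => EuclideanSpace.single i 1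
  have hline : ∀ x i, lineDeriv ℝ (fun x : Conf d => cutoff ‖x‖) x (e i) =
      deriv Real.smoothTransition (2 - ‖x‖ ^ 2) * (-2 * x i) := by
    intro x i
    have h1 : HasDerivAt (fun s : ℝ => 2 - ‖x + s • e i‖ ^ 2) (-2 * x i) 0 := by
      have := ((hasDerivAt_add_smul x (e i) 0).norm_sq).const_sub 2
      refine this.congr_deriv ?_
      simp [e, EuclideanSpace.inner_single_right]
    have h2 : HasDerivAt Real.smoothTransition (deriv Real.smoothTransition (2 - ‖x‖ ^ 2))
        (2 - ‖x + (0 : ℝ) • e i‖ ^ 2) := by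
      rw [zero_smul, add_zero]
      exact ((Real.smoothTransition.contDiff (n := 1)).differentiable one_ne_zero _).hasDerivAt
    exact (h2.comp (0 : ℝ) h1).deriv
  have hsum : ∀ x : Conf d, ∑ i, lineDeriv ℝ (fun x : Conf d => cutoff ‖x‖) x (e i) *
      polyFun (polyField p i) x = 0 := by
    intro x
    have h0 : ∑ i, x i * polyFun (polyField p i) x = 0 := by
      have := congrArg (fun q => polyFun q x) (sum_X_mul_polyField p)
      simpa [polyFun] using this
    simp_rw [hline]
    have : ∀ i, deriv Real.smoothTransition (2 - ‖x‖ ^ 2) * (-2 * x i) * polyFun (polyField p i) x =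
        (-2 * deriv Real.smoothTransition (2 - ‖x‖ ^ 2)) * (x i * polyFun (polyField p i) x) :=
      fun i => by ring
    simp_rw [this, ← Finset.mul_sum, h0, mul_zero]
  have hint : ∀ i, Integrable (fun x : Conf d => cutoff ‖x‖ *
      lineDeriv ℝ (polyFun (polyField p i)) x (e i)) := by
    intro i
    simp_rw [e, lineDeriv_polyFun]
    exact (hsm.continuous.mul (contDiff_polyFun _ (n := 0)).continuous).integrable_of_hasCompactSupport
      hasCompactSupport_cutoff.mul_right
  have key : ∑ i, ∫ x : Conf d, cutoff ‖x‖ * lineDeriv ℝ (polyFun (polyField p i)) x (e i) = 0 := by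
    have := fun i => integral_lineDeriv_mul_contDiff (μ := (volume : Measure (Conf d))) hD
      hasCompactSupport_cutoff (contDiff_polyFun (polyField p i)) (e i)
    have h2 := Finset.sum_congr (rfl : (Finset.univ : Finset (Fin d)) = Finset.univ)
      fun i _ => this i
    rw [← integral_finsetSum _ fun i _ => integrable_lineDeriv_mul hD hasCompactSupport_cutoff
      (contDiff_polyFun _ (n := 0)).continuous (e i)] at h2
    simp_rw [hsum, integral_zero, Finset.sum_neg_distrib] at h2
    linarith
  rw [← integral_finsetSum _ fun i _ => hint i] at key
  rw [← key]
  refine integral_congr_ae (Eventually.of_forall fun x => ?_)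
  simp only [e, lineDeriv_polyFun, ← Finset.mul_sum]
  rw [← sum_pderiv_polyField]
  simp [polyFun]

/-- For homogeneous `p` the integral over `ℝ^d` splits in polar coordinates. -/
lemma integral_polyLaplacian_of_isHomogeneous {p : MvPolynomial (Fin d) ℝ} {n : ℕ}
    (hp : p.IsHomogeneous n) (u₀ : Vel d) :
    ∫ u : Vel d, polyFun (polyLaplacian p) u ∂(volume : Measure (Conf d)).toSphere = 0 := by
  have hq := isHomogeneous_polyLaplacian hp
  have hW : Continuous fun r => cutoff r * r ^ n := continuous_cutoff.mul (continuous_pow n)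
  obtain ⟨C, hC0, hC1, hC⟩ := exists_map_radial u₀ hW
    (fun r hr => mul_nonneg (cutoff_nonneg r) (pow_nonneg hr n))
    (by simp [cutoff, Real.smoothTransition.one_of_one_le (x := 2 - 1) (by norm_num)])
    (fun r hr => by simp [cutoff_eq_zero hr])
  have hcont : Continuous (polyFun (polyLaplacian p)) := (contDiff_polyFun _ (n := 0)).continuous
  have h := congrArg (fun m => ∫ u : Vel d, polyFun (polyLaplacian p) u ∂m) hC
  have hm : Measurable fun v : Conf d => ENNReal.ofReal (cutoff ‖v‖ * ‖v‖ ^ n) :=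
    (hW.comp continuous_norm).measurable.ennreal_ofReal
  have hsm : AEStronglyMeasurable (fun u : Vel d => polyFun (polyLaplacian p) u)
      (Measure.map (radial u₀) ((volume : Measure (Conf d)).withDensity fun v =>
        ENNReal.ofReal (cutoff ‖v‖ * ‖v‖ ^ n))) :=
    (hcont.comp continuous_subtype_val).aestronglyMeasurable
  rw [integral_map (measurable_radial u₀).aemeasurable hsm, integral_smul_measure,
    integral_withDensity_eq_integral_toReal_smul hm (Eventually.of_forall fun _ => ENNReal.ofReal_lt_top)]
    at h
  have hzero : ∫ v : Conf d, (ENNReal.ofReal (cutoff ‖v‖ * ‖v‖ ^ n)).toReal •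
      polyFun (polyLaplacian p) (radial u₀ v : Conf d) = 0 := by
    rw [← integral_cutoff_mul_polyLaplacian p]
    have hne := nontrivial_conf u₀
    have hae : ∀ᵐ v : Conf d, v ≠ 0 := by simp [ae_iff]
    refine integral_congr_ae (hae.mono fun v hv => ?_)
    dsimp only
    rw [ENNReal.toReal_ofReal
      (mul_nonneg (cutoff_nonneg _) (pow_nonneg (norm_nonneg v) n)),
      smul_eq_mul, mul_assoc, ← polyFun_smul hq, norm_smul_radial u₀ hv]
  rw [hzero] at h
  have hCr : C.toReal ≠ 0 := ENNReal.toReal_ne_zero.2 ⟨hC0, hC1⟩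
  exact (smul_eq_zero.1 h.symm).resolve_left hCr

lemma integral_polyLaplacian (p : MvPolynomial (Fin d) ℝ) :
    ∫ u : Vel d, polyFun (polyLaplacian p) u ∂(volume : Measure (Conf d)).toSphere = 0 := by
  rcases isEmpty_or_nonempty (Vel d) with hempty | ⟨⟨u₀⟩⟩
  · simp [integral_of_isEmpty]
  have h : ∀ u : Vel d, polyFun (polyLaplacian p) u =
      ∑ i ∈ Finset.range (p.totalDegree + 1),
        polyFun (polyLaplacian (MvPolynomial.homogeneousComponent i p)) u := by
    intro u
    conv_lhs => rw [← MvPolynomial.sum_homogeneousComponent p, map_sum]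
    simp [polyFun]
  simp_rw [h]
  rw [integral_finsetSum]
  · exact Finset.sum_eq_zero fun i _ => integral_polyLaplacian_of_isHomogeneous
      (MvPolynomial.homogeneousComponent_isHomogeneous i p) u₀
  · intro i _
    exact (((contDiff_polyFun _ (n := 0)).continuous.comp
      continuous_subtype_val).integrable_of_hasCompactSupport (HasCompactSupport.of_compactSpace _))

end MeanZero

section MaximumPrinciple

/-! ### Semigroups generated by locally finite operators with a maximum principle -/

/-- A linear differential equation in finite dimension has a global solution. -/
lemma exists_hasDerivAt_linearMap {V : Type*} [NormedAddCommGroup V] [NormedSpace ℝ V]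
    [FiniteDimensional ℝ V] (B : V →ₗ[ℝ] V) (v : V) :
    ∃ u : ℝ → V, u 0 = v ∧ ∀ t, HasDerivAt u (B (u t)) t := by
  have := FiniteDimensional.complete ℝ V
  let B' : V →L[ℝ] V := LinearMap.toContinuousLinearMap B
  refine ⟨fun t => NormedSpace.exp (t • B') v, by simp, fun t => ?_⟩
  refine ((hasDerivAt_exp_smul_const' B' t).clm_apply (hasDerivAt_const t v)).congr_deriv ?_
  simp [B']

section Pregenerator

variable {X : Type*} [TopologicalSpace X] [CompactSpace X]
  {P : Type*} [AddCommGroup P] [Module ℝ P]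

/-- A densely defined operator `A` on `C(X, ℝ)` which maps its domain to itself, is locally
finite, and satisfies the maximum principle: such an operator generates a unique semigroup of
Markov operators. The domain is given as a vector space `P` with an embedding `ι` into
`C(X, ℝ)`. -/
structure IsPregenerator (ι : P →ₗ[ℝ] C(X, ℝ)) (A : P →ₗ[ℝ] P) : Prop where
  injective : Function.Injective ι
  denseRange : DenseRange ι
  exists_eq_one : ∃ p, ι p = 1
  locallyFinite : ∀ p, ∃ W : Submodule ℝ P, p ∈ W ∧ FiniteDimensional ℝ W ∧ ∀ w ∈ W, A w ∈ W
  apply_nonpos : ∀ p x, (∀ y, ι p y ≤ ι p x) → ι (A p) x ≤ 0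

/-- `u` solves the abstract Cauchy problem `u' = A u` in `C(X, ℝ)`. -/
def IsSolution (ι : P →ₗ[ℝ] C(X, ℝ)) (A : P →ₗ[ℝ] P) (u : ℝ → P) : Prop :=
  ∀ t, HasDerivAt (fun s => ι (u s)) (ι (A (u t))) t

variable {ι : P →ₗ[ℝ] C(X, ℝ)} {A : P →ₗ[ℝ] P} {u v : ℝ → P}

lemma IsPregenerator.exists_isSolution (hA : IsPregenerator ι A) (f : P) :
    ∃ u : ℝ → P, u 0 = f ∧ IsSolution ι A u ∧ IsSolution ι A fun t => A (u t) := by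
  obtain ⟨W, hf, hW, hAW⟩ := hA.locallyFinite f
  -- transport the equation to coordinates, since `W` carries no norm
  let e : W ≃ₗ[ℝ] (Fin (Module.finrank ℝ W) → ℝ) := (Module.finBasis ℝ W).equivFun
  let B : W →ₗ[ℝ] W := A.restrict hAW
  let B' : (Fin (Module.finrank ℝ W) → ℝ) →ₗ[ℝ] (Fin (Module.finrank ℝ W) → ℝ) :=
    e.toLinearMap ∘ₗ B ∘ₗ e.symm.toLinearMap
  obtain ⟨u, hu0, hu⟩ := exists_hasDerivAt_linearMap B' (e ⟨f, hf⟩)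
  let J : (Fin (Module.finrank ℝ W) → ℝ) →L[ℝ] C(X, ℝ) :=
    LinearMap.toContinuousLinearMap (ι ∘ₗ W.subtype ∘ₗ e.symm.toLinearMap)
  let BL : (Fin (Module.finrank ℝ W) → ℝ) →L[ℝ] (Fin (Module.finrank ℝ W) → ℝ) :=
    LinearMap.toContinuousLinearMap B'
  have hJ : ∀ z, J z = ι (e.symm z) := fun z => rfl
  have hB : ∀ z, (e.symm (B' z) : P) = A (e.symm z) := fun z => by
    simp only [B', LinearMap.comp_apply, LinearEquiv.coe_coe, LinearEquiv.symm_apply_apply]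
    rfl
  refine ⟨fun t => e.symm (u t), by simp [hu0], fun t => ?_, fun t => ?_⟩
  · have h := J.hasFDerivAt.comp_hasDerivAt t (hu t)
    rw [hJ, hB] at h
    exact h
  · have h := (J.comp BL).hasFDerivAt.comp_hasDerivAt t (hu t)
    have h2 : (J.comp BL) (B' (u t)) = ι (A (A (e.symm (u t)))) := by
      change J (B' (B' (u t))) = _
      rw [hJ, hB, hB]
    rw [h2] at h
    refine h.congr_of_eventuallyEq (Eventually.of_forall fun s => ?_)
    change _ = J (B' (u s))
    rw [hJ, hB]

lemma IsSolution.continuous (hu : IsSolution ι A u) : Continuous fun s => ι (u s) :=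
  continuous_iff_continuousAt.2 fun t => (hu t).continuousAt

lemma IsSolution.add (hu : IsSolution ι A u) (hv : IsSolution ι A v) :
    IsSolution ι A fun t => u t + v t := fun t => by
  simp only [map_add]
  exact (hu t).add (hv t)

lemma IsSolution.const_smul (hu : IsSolution ι A u) (a : ℝ) :
    IsSolution ι A fun t => a • u t := fun t => by
  simp only [map_smul]
  exact (hu t).const_smul a

lemma IsSolution.sub (hu : IsSolution ι A u) (hv : IsSolution ι A v) :
    IsSolution ι A fun t => u t - v t := fun t => by
  simp only [map_sub]
  exact (hu t).sub (hv t)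

lemma IsSolution.comp_add (hu : IsSolution ι A u) (a : ℝ) : IsSolution ι A fun t => u (t + a) :=
  fun t => (hu (t + a)).comp_add_const t a

lemma IsSolution.hasDerivAt_apply (hu : IsSolution ι A u) (x : X) (t : ℝ) :
    HasDerivAt (fun s => ι (u s) x) (ι (A (u t)) x) t :=
  (ContinuousMap.evalCLM ℝ x : C(X, ℝ) →L[ℝ] ℝ).hasFDerivAt.comp_hasDerivAt t (hu t)

/-- The parabolic maximum principle. -/
lemma IsSolution.le_of_le (hA : IsPregenerator ι A) (hu : IsSolution ι A u) {M : ℝ}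
    (h0 : ∀ x, ι (u 0) x ≤ M) {T : ℝ} (hT : 0 ≤ T) (x : X) : ι (u T) x ≤ M := by
  have key : ∀ ε > 0, ι (u T) x - ε * T ≤ M := by
    intro ε hε
    have hc : Continuous fun p : ℝ × X => ι (u p.1) p.2 - ε * p.1 :=
      ((hu.continuous.comp continuous_fst).eval continuous_snd).sub (by fun_prop)
    obtain ⟨⟨t, y⟩, ⟨ht, -⟩, hmax⟩ := (isCompact_Icc (a := (0 : ℝ)) (b := T)).prod
      (isCompact_univ (X := X)) |>.exists_isMaxOn
      ⟨(0, x), ⟨Set.left_mem_Icc.2 hT, Set.mem_univ _⟩⟩ hc.continuousOn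
    have hle : ∀ s ∈ Set.Icc 0 T, ∀ z, ι (u s) z - ε * s ≤ ι (u t) y - ε * t :=
      fun s hs z => hmax (show (s, z) ∈ Set.Icc 0 T ×ˢ Set.univ from ⟨hs, Set.mem_univ _⟩)
    refine (hle T (Set.right_mem_Icc.2 hT) x).trans ?_
    rcases ht.1.eq_or_lt with rfl | hpos
    · simpa using h0 y
    -- at a maximum with `0 < t` the time derivative of `u - ε t` would be negative
    exfalso
    have h1 : ι (A (u t)) y ≤ 0 := hA.apply_nonpos _ _ fun z => by
      have := hle t ht z
      linarith
    have h2 : HasDerivAt (fun s => ι (u s) y - ε * s) (ι (A (u t)) y - ε) t :=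
      ((hu.hasDerivAt_apply y t).sub ((hasDerivAt_id t).const_mul ε)).congr_deriv (by simp)
    have h3 := (hasDerivWithinAt_iff_tendsto_slope' Set.self_notMem_Iio).1
      (h2.hasDerivWithinAt (s := Set.Iio t))
    have h4 : 0 ≤ ι (A (u t)) y - ε := by
      refine ge_of_tendsto h3 ?_
      filter_upwards [Ioo_mem_nhdsLT hpos] with s hs
      have h5 := hle s ⟨hs.1.le, hs.2.le.trans ht.2⟩ y
      rw [slope_def_field]
      exact div_nonneg_of_nonpos (by linarith) (by linarith [hs.2])
    linarith
  have hlim : Tendsto (fun ε : ℝ => ι (u T) x - ε * T) (𝓝[>] 0) (𝓝 (ι (u T) x - 0 * T)) :=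
    ((continuous_const.sub (continuous_id.mul continuous_const)).tendsto 0).mono_left
      nhdsWithin_le_nhds
  have := le_of_tendsto hlim (eventually_mem_nhdsWithin.mono fun ε hε => key ε hε)
  simpa using this

lemma IsSolution.norm_le (hA : IsPregenerator ι A) (hu : IsSolution ι A u) {T : ℝ} (hT : 0 ≤ T) :
    ‖ι (u T)‖ ≤ ‖ι (u 0)‖ := by
  rw [ContinuousMap.norm_le _ (norm_nonneg _)]
  intro x
  rw [Real.norm_eq_abs, abs_le']
  refine ⟨hu.le_of_le hA (fun y => (le_abs_self _).trans ((ι (u 0)).norm_coe_le_norm y)) hT x, ?_⟩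
  have := (hu.const_smul (-1)).le_of_le hA (M := ‖ι (u 0)‖) (fun y => ?_) hT x
  · simpa using this
  · simpa using (neg_le_abs _).trans ((ι (u 0)).norm_coe_le_norm y)

lemma IsSolution.eq_of_eq (hA : IsPregenerator ι A) (hu : IsSolution ι A u)
    (hv : IsSolution ι A v) (h0 : u 0 = v 0) {T : ℝ} (hT : 0 ≤ T) : u T = v T := by
  have h := (hu.sub hv).norm_le hA hT
  simp only [h0, sub_self, map_zero, norm_zero, norm_le_zero_iff] at h
  exact sub_eq_zero.1 ((injective_iff_map_eq_zero _).1 hA.injective _ h)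

/-- The elliptic maximum principle for `1 - A`. -/
lemma norm_sub_le_of_resolvent [Nonempty X] {G g q w Aw : C(X, ℝ)} (hw : w - Aw = q)
    (hmax : ∀ x, (∀ y, (G - w) y ≤ (G - w) x) → g x ≤ Aw x)
    (hmin : ∀ x, (∀ y, (G - w) x ≤ (G - w) y) → Aw x ≤ g x) :
    ‖G - w‖ ≤ ‖G - g - q‖ := by
  have hpx : ∀ x, w x - Aw x = q x := fun x => by rw [← hw, ContinuousMap.sub_apply]
  rw [ContinuousMap.norm_le _ (norm_nonneg _)]
  intro z
  have hle : ∀ x, |(G - g - q) x| ≤ ‖G - g - q‖ := (G - g - q).norm_coe_le_norm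
  obtain ⟨x, -, hx⟩ := isCompact_univ.exists_isMaxOn (Set.univ_nonempty (α := X))
    (G - w).continuous.continuousOn
  obtain ⟨y, -, hy⟩ := isCompact_univ.exists_isMinOn (Set.univ_nonempty (α := X))
    (G - w).continuous.continuousOn
  replace hx : ∀ z, (G - w) z ≤ (G - w) x := fun z => hx (Set.mem_univ z)
  replace hy : ∀ z, (G - w) y ≤ (G - w) z := fun z => hy (Set.mem_univ z)
  have h1 := hmax x hx
  have h2 := hmin y hy
  have h3 := abs_le.1 (hle x)
  have h4 := abs_le.1 (hle y)
  have h5 := hx z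
  have h6 := hy z
  have h7 := hpx x
  have h8 := hpx y
  simp only [ContinuousMap.sub_apply] at h3 h4 h5 h6 ⊢
  rw [Real.norm_eq_abs, abs_le]
  constructor <;> linarith

/-- On a finite-dimensional invariant subspace, `1 - A` is injective, and so it is onto. -/
lemma IsPregenerator.exists_resolvent [Nonempty X] (hA : IsPregenerator ι A) (p : P) :
    ∃ w : P, w - A w = p := by
  obtain ⟨W, hp, hW, hAW⟩ := hA.locallyFinite p
  let B₀ : W →ₗ[ℝ] W := A.restrict hAW
  let B : W →ₗ[ℝ] W := LinearMap.id - B₀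
  have hBw : ∀ w : W, (B w : P) = w - A w := fun w => rfl
  have hinj : Function.Injective B := by
    rw [injective_iff_map_eq_zero]
    intro w hw
    have hw' : ι w - ι (A w) = 0 := by rw [← map_sub, ← hBw, hw]; simp
    have h := norm_sub_le_of_resolvent (G := 0) (g := 0) hw' (fun x hx => ?_) (fun x hx => ?_)
    · simp only [zero_sub, sub_zero, norm_neg, norm_zero, norm_le_zero_iff] at h
      exact Subtype.ext ((injective_iff_map_eq_zero _).1 hA.injective _ h)
    · have := hA.apply_nonpos (-(w : P)) x (by simpa using hx)
      simpa using this
    · exact hA.apply_nonpos w x (by simpa using hx)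
  obtain ⟨w, hw⟩ := LinearMap.injective_iff_surjective.1 hinj ⟨p, hp⟩
  exact ⟨w, by rw [← hBw, hw]⟩

/-- A function which obeys the maximum principle together with the domain of `A` lies in the domain
of the closure of `A`. -/
lemma IsPregenerator.exists_approx [Nonempty X] (hA : IsPregenerator ι A) {G g : C(X, ℝ)}
    (hmax : ∀ p x, (∀ y, (G - ι p) y ≤ (G - ι p) x) → g x ≤ ι (A p) x)
    (hmin : ∀ p x, (∀ y, (G - ι p) x ≤ (G - ι p) y) → ι (A p) x ≤ g x) {ε : ℝ} (hε : 0 < ε) :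
    ∃ w, ‖G - ι w‖ ≤ ε ∧ ‖g - ι (A w)‖ ≤ ε := by
  obtain ⟨p, hp⟩ := hA.denseRange.exists_dist_lt (G - g) (half_pos hε)
  rw [dist_eq_norm] at hp
  obtain ⟨w, hw⟩ := hA.exists_resolvent p
  have hw' : ι w - ι (A w) = ι p := by rw [← map_sub, hw]
  have h1 := norm_sub_le_of_resolvent hw' (hmax w) (hmin w)
  refine ⟨w, by linarith, ?_⟩
  have h2 : g - ι (A w) = (G - ι w) - (G - g - ι p) := by rw [← hw']; abel
  rw [h2]
  linarith [norm_sub_le (G - ι w) (G - g - ι p)]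

end Pregenerator

end MaximumPrinciple

section MarkovSemigroup

/-! ### The semigroup of operators -/

section Semigroup

variable {X : Type*} [TopologicalSpace X] [CompactSpace X]
  {P : Type*} [AddCommGroup P] [Module ℝ P]
  {ι : P →ₗ[ℝ] C(X, ℝ)} {A : P →ₗ[ℝ] P} {u : ℝ → P}

/-- `T` is the contraction semigroup on `C(X, ℝ)` which solves the Cauchy problem of `A`. -/
structure IsSemigroup (ι : P →ₗ[ℝ] C(X, ℝ)) (A : P →ₗ[ℝ] P)
    (T : ℝ≥0 → C(X, ℝ) →L[ℝ] C(X, ℝ)) : Prop where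
  norm_le : ∀ t f, ‖T t f‖ ≤ ‖f‖
  apply_solution : ∀ u, IsSolution ι A u → ∀ t, T t (ι (u 0)) = ι (u t)

/-- The solution operators are contractions on a dense subspace, and extend continuously. -/
lemma IsPregenerator.exists_isSemigroup (hA : IsPregenerator ι A) :
    ∃ T, IsSemigroup ι A T := by
  choose sol hsol0 hsol _ using hA.exists_isSolution
  have huniq : ∀ u, IsSolution ι A u → ∀ t : ℝ≥0, sol (u 0) t = u t := fun u hu t =>
    (hsol (u 0)).eq_of_eq hA hu (hsol0 _) t.2
  let T₀ (t : ℝ≥0) : P →ₗ[ℝ] C(X, ℝ) :=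
    { toFun p := ι (sol p t)
      map_add' p q := by
        have := huniq _ ((hsol p).add (hsol q)) t
        simp only [hsol0] at this
        rw [this, map_add]
      map_smul' c p := by
        have := huniq _ ((hsol p).const_smul c) t
        simp only [hsol0] at this
        rw [this, map_smul, RingHom.id_apply] }
  have hT₀ : ∀ t p, ‖T₀ t p‖ ≤ 1 * ‖ι p‖ := fun t p => by
    have := (hsol p).norm_le hA t.2
    rw [hsol0] at this
    rw [one_mul]
    exact this
  refine ⟨fun t => (T₀ t).extendOfNorm ι, fun t f => ?_, fun u hu t => ?_⟩
  · simpa using LinearMap.norm_extendOfNorm_apply_le hA.denseRange 1 (hT₀ t) f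
  · rw [LinearMap.extendOfNorm_eq hA.denseRange ⟨1, hT₀ t⟩]
    change ι (sol (u 0) t) = ι (u t)
    rw [huniq u hu]

variable {T : ℝ≥0 → C(X, ℝ) →L[ℝ] C(X, ℝ)}

lemma IsSemigroup.zero (hA : IsPregenerator ι A) (hT : IsSemigroup ι A T) (f : C(X, ℝ)) :
    T 0 f = f := by
  refine congrFun (hA.denseRange.equalizer (T 0).continuous continuous_id (funext fun p => ?_)) f
  obtain ⟨u, rfl, hu, -⟩ := hA.exists_isSolution p
  simpa using hT.apply_solution u hu 0

lemma IsSemigroup.add (hA : IsPregenerator ι A) (hT : IsSemigroup ι A T) (s t : ℝ≥0)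
    (f : C(X, ℝ)) : T (s + t) f = T t (T s f) := by
  refine congrFun (hA.denseRange.equalizer (T (s + t)).continuous
    ((T t).continuous.comp (T s).continuous) (funext fun p => ?_)) f
  obtain ⟨u, rfl, hu, -⟩ := hA.exists_isSolution p
  have h := hT.apply_solution _ (hu.comp_add s) t
  simp only [zero_add] at h
  simp only [Function.comp_apply, hT.apply_solution u hu, h]
  rw [NNReal.coe_add, add_comm]

lemma IsSemigroup.one (hA : IsPregenerator ι A) (hT : IsSemigroup ι A T) (t : ℝ≥0) :
    T t 1 = 1 := by
  obtain ⟨p, hp⟩ := hA.exists_eq_one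
  have h0 : ι (A p) = 0 := by
    ext x
    refine le_antisymm (hA.apply_nonpos p x (by simp [hp])) ?_
    have := hA.apply_nonpos (-p) x (by simp [hp])
    simpa using this
  have hsol : IsSolution ι A fun _ => p := fun t => by
    rw [h0]
    exact hasDerivAt_const t _
  rw [← hp]
  exact hT.apply_solution _ hsol t

/-- A unital contraction is positive. -/
lemma IsSemigroup.nonneg (hA : IsPregenerator ι A) (hT : IsSemigroup ι A T) (t : ℝ≥0)
    {f : C(X, ℝ)} (hf : 0 ≤ f) : 0 ≤ T t f := by
  intro x
  have h1 : ‖‖f‖ • (1 : C(X, ℝ)) - f‖ ≤ ‖f‖ := by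
    rw [ContinuousMap.norm_le _ (norm_nonneg _)]
    intro y
    have h2 : f y ≤ ‖f‖ := (le_abs_self _).trans (f.norm_coe_le_norm y)
    have h3 : 0 ≤ f y := hf y
    simp only [ContinuousMap.sub_apply, ContinuousMap.smul_apply, ContinuousMap.one_apply,
      smul_eq_mul, mul_one, Real.norm_eq_abs]
    rw [abs_le]
    constructor <;> linarith
  have h2 := (le_abs_self _).trans (((T t (‖f‖ • (1 : C(X, ℝ)) - f)).norm_coe_le_norm x).trans
    ((hT.norm_le t _).trans h1))
  rw [map_sub, map_smul, hT.one hA] at h2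
  simp only [ContinuousMap.sub_apply, ContinuousMap.smul_apply, ContinuousMap.one_apply,
      smul_eq_mul, mul_one] at h2
  change 0 ≤ T t f x
  linarith

/-- Strong continuity. -/
lemma IsSemigroup.eventually_norm_sub_le (hA : IsPregenerator ι A) (hT : IsSemigroup ι A T)
    (f : C(X, ℝ)) {ε : ℝ} (hε : 0 < ε) : ∀ᶠ t in 𝓝 (0 : ℝ≥0), ‖T t f - f‖ ≤ ε := by
  obtain ⟨p, hp⟩ := hA.denseRange.exists_dist_lt f (by positivity : 0 < ε / 3)
  obtain ⟨u, rfl, hu, -⟩ := hA.exists_isSolution p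
  rw [dist_eq_norm] at hp
  have hc : Tendsto (fun t : ℝ≥0 => ι (u t)) (𝓝 0) (𝓝 (ι (u 0))) :=
    (hu.continuous.comp NNReal.continuous_coe).tendsto' 0 _ (by simp)
  filter_upwards [hc.eventually (Metric.ball_mem_nhds _ (by positivity : 0 < ε / 3))] with t ht
  have ht' : ‖ι (u t) - ι (u 0)‖ < ε / 3 := by
    rw [← dist_eq_norm]
    exact ht
  have h1 : T t f - f = T t (f - ι (u 0)) + (ι (u t) - ι (u 0)) - (f - ι (u 0)) := by
    rw [map_sub, hT.apply_solution u hu]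
    abel
  have h2 := hT.norm_le t (f - ι (u 0))
  rw [h1]
  have h3 := norm_sub_le (T t (f - ι (u 0)) + (ι (u t) - ι (u 0))) (f - ι (u 0))
  have h4 := norm_add_le (T t (f - ι (u 0))) (ι (u t) - ι (u 0))
  linarith

/-- The first order expansion of the semigroup: if `G` is a limit of functions `ι w` with
`ι (A w) → g`, then `T t G - G` is the integral of `T s g`, which is close to `g`. -/
lemma IsSemigroup.norm_sub_sub_le (hA : IsPregenerator ι A) (hT : IsSemigroup ι A T)
    {G g : C(X, ℝ)} (happ : ∀ ε > 0, ∃ w, ‖G - ι w‖ ≤ ε ∧ ‖g - ι (A w)‖ ≤ ε) {ε : ℝ} {t : ℝ≥0}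
    (ht : ∀ s ≤ t, ‖T s g - g‖ ≤ ε) : ‖T t G - G - (t : ℝ) • g‖ ≤ ε * t := by
  have key : ∀ δ > 0, ‖T t G - G - (t : ℝ) • g‖ ≤ 2 * δ + (δ + ε) * t := by
    intro δ hδ
    obtain ⟨w, hw, hAw⟩ := happ δ hδ
    obtain ⟨u, rfl, hu, hu'⟩ := hA.exists_isSolution w
    have hF : ∀ s ∈ Set.Icc (0 : ℝ) t, HasDerivWithinAt (fun s : ℝ => ι (u s) - s • g)
        (ι (A (u s)) - g) (Set.Icc (0 : ℝ) t) s := fun s _ => by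
      have := (hu s).sub ((hasDerivAt_id s).smul_const g)
      rw [one_smul] at this
      exact this.hasDerivWithinAt
    have hb : ∀ s ∈ Set.Ico (0 : ℝ) t, ‖ι (A (u s)) - g‖ ≤ δ + ε := fun s hs => by
      lift s to ℝ≥0 using hs.1
      have h1 : ι (A (u s)) - g = (T s g - g) - T s (g - ι (A (u 0))) := by
        rw [map_sub, hT.apply_solution _ hu']
        abel
      rw [h1]
      have h2 := hT.norm_le s (g - ι (A (u 0)))
      have h3 := ht s (NNReal.coe_le_coe.1 hs.2.le)
      have h4 := norm_sub_le (T s g - g) (T s (g - ι (A (u 0))))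
      linarith
    have h5 := norm_image_sub_le_of_norm_deriv_le_segment' hF hb t (Set.right_mem_Icc.2 t.2)
    have h6 : T t G - G - (t : ℝ) • g = T t (G - ι (u 0)) - (G - ι (u 0)) +
        (ι (u t) - (t : ℝ) • g - (ι (u 0) - (0 : ℝ) • g)) := by
      rw [map_sub, hT.apply_solution u hu, zero_smul]
      abel
    rw [h6]
    have h7 := hT.norm_le t (G - ι (u 0))
    have h8 := norm_add_le (T t (G - ι (u 0)) - (G - ι (u 0)))
      (ι (u t) - (t : ℝ) • g - (ι (u 0) - (0 : ℝ) • g))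
    have h9 := norm_sub_le (T t (G - ι (u 0))) (G - ι (u 0))
    simp only [sub_zero] at h5
    linarith
  have hlim : Tendsto (fun δ : ℝ => 2 * δ + (δ + ε) * t) (𝓝[>] 0) (𝓝 (2 * 0 + (0 + ε) * t)) := by
    have : Continuous fun δ : ℝ => 2 * δ + (δ + ε) * t := by fun_prop
    exact (this.tendsto 0).mono_left nhdsWithin_le_nhds
  have := ge_of_tendsto hlim (eventually_mem_nhdsWithin.mono fun δ hδ => key δ hδ)
  simpa using this

/-- The generator of the semigroup on the functions in the domain of the closure of `A`. -/
lemma IsSemigroup.eventually_norm_sub_sub_le (hA : IsPregenerator ι A) (hT : IsSemigroup ι A T)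
    {G g : C(X, ℝ)} (happ : ∀ ε > 0, ∃ w, ‖G - ι w‖ ≤ ε ∧ ‖g - ι (A w)‖ ≤ ε) {ε : ℝ}
    (hε : 0 < ε) : ∀ᶠ t in 𝓝 (0 : ℝ≥0), ‖T t G - G - (t : ℝ) • g‖ ≤ ε * t := by
  obtain ⟨δ, hδ, h⟩ := NNReal.nhds_zero_basis.eventually_iff.1 (hT.eventually_norm_sub_le hA g hε)
  refine NNReal.nhds_zero_basis.eventually_iff.2 ⟨δ, hδ, fun t ht => ?_⟩
  exact hT.norm_sub_sub_le hA happ fun s hs => h (lt_of_le_of_lt hs ht)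

end Semigroup

/-! ### Kernels of Markov operators -/

section Kernels

variable {X : Type*} [TopologicalSpace X] [MeasurableSpace X] [BorelSpace X]

lemma integrable_continuousMap [CompactSpace X] (f : C(X, ℝ)) (μ : Measure X) [IsFiniteMeasure μ] :
    Integrable f μ :=
  f.continuous.integrable_of_hasCompactSupport (HasCompactSupport.of_compactSpace _)

lemma ext_of_forall_integral_continuousMap_eq [HasOuterApproxClosed X] {μ ν : Measure X} [IsFiniteMeasure μ]
    [IsFiniteMeasure ν] (h : ∀ f : C(X, ℝ), ∫ x, f x ∂μ = ∫ x, f x ∂ν) : μ = ν :=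
  ext_of_forall_integral_eq_of_IsFiniteMeasure fun f => h f.toContinuousMap

/-- The indicators of closed sets, which generate the Borel sets, are limits of continuous
functions. -/
lemma measurable_of_continuous_integral [HasOuterApproxClosed X] {κ : X → Measure X} [∀ x, IsProbabilityMeasure (κ x)]
    (h : ∀ f : C(X, ℝ), Continuous fun x => ∫ y, f y ∂κ x) : Measurable κ := by
  refine .measure_of_isPiSystem_of_isProbabilityMeasure
    ((BorelSpace.measurable_eq (α := X)).trans borel_eq_generateFrom_isClosed)
    isPiSystem_isClosed fun F hF => ?_
  replace hF : IsClosed F := hF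
  refine measurable_of_tendsto_metrizable (f := fun n x => ∫⁻ y, hF.apprSeq n y ∂κ x)
    (fun n => ?_) (tendsto_pi_nhds.2 fun x => HasOuterApproxClosed.tendsto_lintegral_apprSeq hF (κ x))
  have h1 : (fun x => ∫⁻ y, hF.apprSeq n y ∂κ x) =
      fun x => ENNReal.ofReal (∫ y, (hF.apprSeq n y : ℝ) ∂κ x) := by
    ext x
    rw [← BoundedContinuousFunction.toReal_lintegral_coe_eq_integral, ENNReal.ofReal_toReal
      (BoundedContinuousFunction.lintegral_lt_top_of_nnreal (κ x) _).ne]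
  rw [h1]
  exact (h ⟨fun y => (hF.apprSeq n y : ℝ), by fun_prop⟩).measurable.ennreal_ofReal

/-- A Markov operator on `C(X, ℝ)` is given by a kernel. -/
lemma exists_kernel_of_markovOperator [CompactSpace X] [T2Space X] [HasOuterApproxClosed X]
    (T : C(X, ℝ) →ₗ[ℝ] C(X, ℝ)) (hpos : ∀ f, 0 ≤ f → 0 ≤ T f)
    (h1 : T 1 = 1) :
    ∃ κ : Kernel X X, IsMarkovKernel κ ∧ ∀ f : C(X, ℝ), ∀ x, ∫ y, f y ∂κ x = T f x := by
  let Λ (x : X) : CompactlySupportedContinuousMap X ℝ →ₚ[ℝ] ℝ :=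
    { toFun g := T g.toContinuousMap x
      map_add' g g' := by
        have : (g + g').toContinuousMap = g.toContinuousMap + g'.toContinuousMap := rfl
        rw [this, map_add, ContinuousMap.add_apply]
      map_smul' c g := by
        have : (c • g).toContinuousMap = c • g.toContinuousMap := rfl
        rw [this, map_smul, ContinuousMap.smul_apply, RingHom.id_apply]
      monotone' g g' hgg' := by
        have := hpos (g'.toContinuousMap - g.toContinuousMap) (sub_nonneg.2 fun y => hgg' y) x
        rw [map_sub] at this
        exact sub_nonneg.1 this }
  let κ (x : X) : Measure X := RealRMK.rieszMeasure (Λ x)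
  have hκ : ∀ (f : C(X, ℝ)) x, ∫ y, f y ∂κ x = T f x := fun f x =>
    RealRMK.integral_rieszMeasure (Λ x) ⟨f, HasCompactSupport.of_compactSpace _⟩
  have hprob : ∀ x, IsProbabilityMeasure (κ x) := fun x => by
    have := hκ 1 x
    rw [h1] at this
    simp only [ContinuousMap.one_apply, integral_const, smul_eq_mul, mul_one] at this
    exact ⟨by rwa [Measure.real, ENNReal.toReal_eq_one_iff] at this⟩
  refine ⟨⟨κ, measurable_of_continuous_integral fun f => ?_⟩, ⟨hprob⟩, hκ⟩
  simp_rw [hκ]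
  exact (T f).continuous

end Kernels

end MarkovSemigroup

section Uniqueness

/-! ### Kernel semigroups with a given generator -/

lemma abs_integral_le_of_abs_le {X : Type*} [MeasurableSpace X]
    {μ : Measure X} [IsProbabilityMeasure μ] {f : X → ℝ} {C : ℝ}
    (h : ∀ x, |f x| ≤ C) : |∫ x, f x ∂μ| ≤ C := by
  simpa using norm_integral_le_of_norm_le_const (μ := μ) (f := f)
    (Eventually.of_forall fun x => (Real.norm_eq_abs (f x)).trans_le (h x))

section KernelSemigroup

variable {X : Type*} [TopologicalSpace X] [CompactSpace X] [MeasurableSpace X]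
  {P : Type*} [AddCommGroup P] [Module ℝ P]
  {ι : P →ₗ[ℝ] C(X, ℝ)} {A : P →ₗ[ℝ] P} {u : ℝ → P}

/-- `K` is a semigroup of Markov kernels whose generator extends `A`. -/
structure IsKernelSemigroup (ι : P →ₗ[ℝ] C(X, ℝ)) (A : P →ₗ[ℝ] P) (K : ℝ≥0 → Kernel X X) :
    Prop where
  markov : ∀ t, IsMarkovKernel (K t)
  zero : K 0 = Kernel.id
  add : ∀ s t, K (s + t) = K t ∘ₖ K s
  generator : ∀ p, ∀ ε > 0, ∀ᶠ t in 𝓝 (0 : ℝ≥0), ∀ x,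
    |(∫ y, ι p y ∂(K t x)) - ι p x - t * ι (A p) x| ≤ ε * t

variable {K : ℝ≥0 → Kernel X X}

lemma IsKernelSemigroup.eventually_abs_sub_le (hK : IsKernelSemigroup ι A K) (p : P) {ε : ℝ}
    (hε : 0 < ε) :
    ∀ᶠ t in 𝓝 (0 : ℝ≥0), ∀ x, |(∫ y, ι p y ∂(K t x)) - ι p x| ≤ ε := by
  have hlim : Tendsto (fun t : ℝ≥0 => (t : ℝ) * (1 + ‖ι (A p)‖)) (𝓝 0) (𝓝 0) :=
    (NNReal.continuous_coe.mul continuous_const).tendsto' 0 _ (by simp)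
  filter_upwards [hK.generator p 1 one_pos, hlim.eventually (Iic_mem_nhds hε)] with t h1 h2 x
  have h3 := abs_le.1 (h1 x)
  have h4 := abs_le.1 ((ι (A p)).norm_coe_le_norm x)
  have h5 : |(t : ℝ) * ι (A p) x| ≤ t * ‖ι (A p)‖ := by
    rw [abs_mul, NNReal.abs_eq]
    exact mul_le_mul_of_nonneg_left ((ι (A p)).norm_coe_le_norm x) t.2
  have h6 := abs_le.1 h5
  have h7 : (t : ℝ) * (1 + ‖ι (A p)‖) ≤ ε := h2
  rw [abs_le]
  constructor <;> linarith

variable [BorelSpace X]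

/-- Integration as a continuous functional on `C(X, ℝ)`. -/
noncomputable def integralCLM (μ : Measure X) [IsFiniteMeasure μ] : C(X, ℝ) →L[ℝ] ℝ :=
  LinearMap.mkContinuous
    { toFun f := ∫ x, f x ∂μ
      map_add' f g := integral_add (integrable_continuousMap f μ) (integrable_continuousMap g μ)
      map_smul' c f := integral_const_mul c f }
    (μ.real Set.univ) fun f => by
      rw [mul_comm]
      exact norm_integral_le_of_norm_le_const (Eventually.of_forall f.norm_coe_le_norm)

lemma integralCLM_apply (μ : Measure X) [IsFiniteMeasure μ] (f : C(X, ℝ)) :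
    integralCLM μ f = ∫ x, f x ∂μ := rfl

/-- Along a solution, the action of the kernel is compensated to first order by the backward
evolution. -/
lemma IsKernelSemigroup.eventually_abs_backward_le (hK : IsKernelSemigroup ι A K)
    (hu : IsSolution ι A u) (r : ℝ) {ε : ℝ} (hε : 0 < ε) :
    ∀ᶠ t in 𝓝 (0 : ℝ≥0), ∀ x, |(∫ y, ι (u (r - t)) y ∂(K t x)) - ι (u r) x| ≤ ε * t := by
  have hε3 : 0 < ε / 3 := by positivity
  have hder := (hasDerivAt_iff_isLittleO_nhds_zero.1 (hu r)).def hε3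
  have hlim : Tendsto (fun t : ℝ≥0 => -(t : ℝ)) (𝓝 0) (𝓝 0) :=
    NNReal.continuous_coe.neg.tendsto' 0 _ (by simp)
  filter_upwards [hK.generator (u r) _ hε3, hK.eventually_abs_sub_le (A (u r)) hε3,
    hlim.eventually hder] with t h1 h2 h3 x
  have := hK.markov t
  let f : C(X, ℝ) := ι (u (r + -t)) - ι (u r) - (-(t : ℝ)) • ι (A (u r))
  have h4 : |∫ y, f y ∂(K t x)| ≤ ε / 3 * t := by
    refine abs_integral_le_of_abs_le fun y => (f.norm_coe_le_norm y).trans ?_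
    simpa [f] using h3
  have h5 : ∫ y, f y ∂(K t x) = (∫ y, ι (u (r - t)) y ∂(K t x)) - (∫ y, ι (u r) y ∂(K t x))
      + t * ∫ y, ι (A (u r)) y ∂(K t x) := by
    have hf : ∀ y, f y = ι (u (r - t)) y - ι (u r) y + t * ι (A (u r)) y := fun y => by
      simp [f, sub_eq_add_neg]
    simp_rw [hf]
    rw [integral_add, integral_sub, integral_const_mul]
    · exact integrable_continuousMap _ _
    · exact integrable_continuousMap _ _
    · exact (integrable_continuousMap _ _).sub (integrable_continuousMap _ _)
    · exact (integrable_continuousMap _ _).const_mul _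
  rw [h5] at h4
  have h6 : |(t : ℝ) * ((∫ y, ι (A (u r)) y ∂(K t x)) - ι (A (u r)) x)| ≤ t * (ε / 3) := by
    rw [abs_mul, NNReal.abs_eq]
    exact mul_le_mul_of_nonneg_left (h2 x) t.2
  have h7 := abs_le.1 (h1 x)
  have h8 := abs_le.1 h4
  have h9 := abs_le.1 h6
  rw [abs_le]
  constructor <;> linarith

/-- An estimate for `K t`, uniform in the starting point, carries over from time `s` to `s + t`. -/
lemma IsKernelSemigroup.abs_integral_add_sub_le (hK : IsKernelSemigroup ι A K) {f g : C(X, ℝ)}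
    {s t : ℝ≥0} {C : ℝ} (h : ∀ y, |(∫ z, f z ∂(K t y)) - g y| ≤ C) (x : X) :
    |(∫ z, f z ∂(K (s + t) x)) - ∫ y, g y ∂(K s x)| ≤ C := by
  have := hK.markov s
  have := hK.markov t
  have hint : Integrable f ((K t ∘ₖ K s) x) := integrable_continuousMap _ _
  rw [hK.add, Kernel.integral_comp hint,
    ← integral_sub hint.integral_comp (integrable_continuousMap _ _)]
  exact abs_integral_le_of_abs_le h

/-- The function `s ↦ ∫ u (t - s) d(K s x)` is constant, since its right derivative vanishes. -/
lemma IsKernelSemigroup.integral_eq (hK : IsKernelSemigroup ι A K) (hu : IsSolution ι A u)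
    (t : ℝ≥0) (x : X) : ∫ y, ι (u 0) y ∂(K t x) = ι (u t) x := by
  let h : ℝ → ℝ := fun s => ∫ y, ι (u (t - s)) y ∂(K s.toNNReal x)
  have hderiv : ∀ s ∈ Set.Ici (0 : ℝ), HasDerivWithinAt h 0 (Set.Ici s) s := by
    intro s hs
    rw [hasDerivWithinAt_iff_isLittleO, Asymptotics.isLittleO_iff]
    intro ε hε
    have hlim : Tendsto (fun s' : ℝ => (s' - s).toNNReal) (𝓝[≥] s) (𝓝 0) :=
      ((continuous_real_toNNReal.comp (continuous_id.sub continuous_const)).tendsto' s 0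
        (by simp)).mono_left nhdsWithin_le_nhds
    filter_upwards [hlim.eventually (hK.eventually_abs_backward_le hu (t - s) hε),
      self_mem_nhdsWithin] with s' h1 hs'
    have hs0 : (0 : ℝ) ≤ s := hs
    have hs1 : s ≤ s' := hs'
    have e1 : ((s' - s).toNNReal : ℝ) = s' - s := Real.coe_toNNReal _ (sub_nonneg.2 hs1)
    have e2 : s.toNNReal + (s' - s).toNNReal = s'.toNNReal := by
      rw [← Real.toNNReal_add hs0 (sub_nonneg.2 hs1), add_sub_cancel]
    rw [e1] at h1
    have h2 := hK.abs_integral_add_sub_le (s := s.toNNReal) h1 x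
    rw [e2, show (t : ℝ) - s - (s' - s) = t - s' by ring] at h2
    rw [smul_zero, sub_zero, Real.norm_eq_abs, Real.norm_of_nonneg (sub_nonneg.2 hs1)]
    exact h2
  have hleft : ∀ s ∈ Set.Icc (0 : ℝ) t, ContinuousWithinAt h (Set.Icc 0 s) s := by
    intro s hs
    rw [ContinuousWithinAt, Metric.tendsto_nhds]
    intro ε hε
    have hlim : Tendsto (fun s' : ℝ => (s - s').toNNReal) (𝓝[Set.Icc 0 s] s) (𝓝 0) :=
      ((continuous_real_toNNReal.comp (continuous_const.sub continuous_id)).tendsto' s 0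
        (by simp)).mono_left nhdsWithin_le_nhds
    have hcont : Tendsto (fun s' : ℝ => ι (u (t - s'))) (𝓝[Set.Icc 0 s] s) (𝓝 (ι (u (t - s)))) :=
      ((hu.continuous.comp (continuous_const.sub continuous_id)).tendsto s).mono_left
        nhdsWithin_le_nhds
    have hε3 : 0 < ε / 3 := by positivity
    filter_upwards [hlim.eventually (hK.eventually_abs_sub_le (u (t - s)) hε3),
      hcont.eventually (Metric.ball_mem_nhds _ hε3), self_mem_nhdsWithin] with s' h1 h2 hs'
    have h3 : ‖ι (u (t - s')) - ι (u (t - s))‖ < ε / 3 := by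
      rw [← dist_eq_norm]
      exact h2
    have e2 : s'.toNNReal + (s - s').toNNReal = s.toNNReal := by
      rw [← Real.toNNReal_add hs'.1 (sub_nonneg.2 hs'.2), add_sub_cancel]
    have h4 := hK.abs_integral_add_sub_le (s := s'.toNNReal) (t := (s - s').toNNReal)
      (f := ι (u (t - s))) (g := ι (u (t - s'))) (C := 2 * (ε / 3)) (fun y => ?_) x
    · rw [e2] at h4
      rw [dist_comm, Real.dist_eq]
      exact h4.trans_lt (by linarith)
    · have h5 := abs_le.1 (h1 y)
      have h6 := abs_le.1 ((ι (u (t - s')) - ι (u (t - s))).norm_coe_le_norm y)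
      rw [ContinuousMap.sub_apply] at h6
      rw [abs_le]
      constructor <;> linarith
  have hcont : ContinuousOn h (Set.Icc 0 t) := fun s hs =>
    ((hleft s hs).union (hderiv s hs.1).continuousWithinAt).mono fun s' hs' => by
      rcases le_total s' s with h1 | h1
      · exact Or.inl ⟨hs'.1, h1⟩
      · exact Or.inr h1
  have key := constant_of_has_deriv_right_zero hcont (fun s hs => hderiv s hs.1) t
    (Set.right_mem_Icc.2 t.2)
  simp only [h, sub_self, sub_zero, Real.toNNReal_coe, Real.toNNReal_zero, hK.zero,
    Kernel.id_apply] at key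
  rw [key]
  exact integral_dirac' _ _ (ι (u t)).continuous.stronglyMeasurable

lemma eq_of_integral_eq (hA : IsPregenerator ι A) {μ ν : Measure X} [IsFiniteMeasure μ]
    [IsFiniteMeasure ν] [HasOuterApproxClosed X] (h : ∀ p, ∫ x, ι p x ∂μ = ∫ x, ι p x ∂ν) :
    μ = ν := by
  refine ext_of_forall_integral_continuousMap_eq fun f => ?_
  exact congrFun (hA.denseRange.equalizer (integralCLM μ).continuous (integralCLM ν).continuous
    (funext h)) f

lemma IsKernelSemigroup.eq [HasOuterApproxClosed X] (hA : IsPregenerator ι A)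
    (hK : IsKernelSemigroup ι A K) {K' : ℝ≥0 → Kernel X X} (hK' : IsKernelSemigroup ι A K') :
    K = K' := by
  ext1 t
  ext1 x
  have := hK.markov t
  have := hK'.markov t
  refine eq_of_integral_eq hA fun p => ?_
  obtain ⟨u, rfl, hu, -⟩ := hA.exists_isSolution p
  rw [hK.integral_eq hu, hK'.integral_eq hu]

/-- A measure annihilated by the generator is invariant. -/
lemma IsKernelSemigroup.invariant [HasOuterApproxClosed X] (hA : IsPregenerator ι A)
    (hK : IsKernelSemigroup ι A K) {σ : Measure X} [IsFiniteMeasure σ]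
    (hσ : ∀ p, ∫ x, ι (A p) x ∂σ = 0) (t : ℝ≥0) : K t ∘ₘ σ = σ := by
  have := hK.markov t
  refine eq_of_integral_eq hA fun p => ?_
  obtain ⟨u, rfl, hu, -⟩ := hA.exists_isSolution p
  have hint : Integrable (ι (u 0)) (K t ∘ₘ σ) := integrable_continuousMap _ _
  rw [Measure.comp_eq_comp_const_apply] at hint ⊢
  rw [Kernel.integral_comp hint, Kernel.const_apply]
  simp_rw [hK.integral_eq hu]
  have hd : ∀ s, HasDerivAt (fun s => integralCLM σ (ι (u s))) 0 s := fun s => by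
    have h := (integralCLM σ).hasFDerivAt.comp_hasDerivAt s (hu s)
    rwa [integralCLM_apply σ (ι (A (u s))), hσ] at h
  exact is_const_of_deriv_eq_zero (fun s => (hd s).differentiableAt) (fun s => (hd s).deriv) _ _

end KernelSemigroup

end Uniqueness

section Brownian

variable {d : ℕ} {η : ℝ} {K : ℝ≥0 → Kernel (Vel d) (Vel d)}

/-! ### Brownian motion on the sphere -/

/-- The restriction of polynomials to the sphere. -/
noncomputable def polyC : MvPolynomial (Fin d) ℝ →ₐ[ℝ] C(Vel d, ℝ) :=
  MvPolynomial.aeval fun i => ⟨fun u : Vel d => (u : Conf d) i, by fun_prop⟩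

lemma polyC_apply (p : MvPolynomial (Fin d) ℝ) (u : Vel d) : polyC p u = polyFun p u := by
  induction p using MvPolynomial.induction_on with
  | C a => simp [polyC, polyFun]
  | add p q hp hq => simp_all [polyFun]
  | mul_X p i hp =>
    rw [map_mul, ContinuousMap.mul_apply, hp]
    simp [polyC, polyFun]

/-- The Stone-Weierstrass theorem: the coordinates separate the points of the sphere. -/
lemma denseRange_polyC : DenseRange (polyC (d := d)) := by
  have h : (polyC (d := d)).range.topologicalClosure = ⊤ := by
    refine ContinuousMap.subalgebra_topologicalClosure_eq_top_of_separatesPoints _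
      fun u v huv => ?_
    obtain ⟨i, hi⟩ : ∃ i, (u : Conf d) i ≠ (v : Conf d) i := by
      by_contra! h
      exact huv (Subtype.ext (PiLp.ext h))
    exact ⟨polyC (MvPolynomial.X i), ⟨_, ⟨_, rfl⟩, rfl⟩, by simpa [polyC_apply, polyFun] using hi⟩
  have h2 := congrArg (fun S : Subalgebra ℝ C(Vel d, ℝ) => (S : Set C(Vel d, ℝ))) h
  simp only [Subalgebra.topologicalClosure_coe, Algebra.coe_top, AlgHom.coe_range] at h2
  exact dense_iff_closure_eq.2 h2

/-- The polynomial functions on the sphere. -/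
noncomputable abbrev polySpace (d : ℕ) : Submodule ℝ C(Vel d, ℝ) :=
  LinearMap.range (polyC (d := d)).toLinearMap

/-- The surjection of polynomials onto the polynomial functions. -/
noncomputable def toPolySpace : MvPolynomial (Fin d) ℝ →ₗ[ℝ] polySpace d :=
  (polyC (d := d)).toLinearMap.rangeRestrict

lemma toPolySpace_surjective : Function.Surjective (toPolySpace (d := d)) :=
  LinearMap.surjective_rangeRestrict _

lemma coe_toPolySpace (p : MvPolynomial (Fin d) ℝ) : (toPolySpace p : C(Vel d, ℝ)) = polyC p := rfl

/-- The operator `(η² / 2) Δ` on the polynomial functions on the sphere. It is computed on some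
polynomial representing the function. -/
noncomputable def brownianGenerator (η : ℝ) : polySpace d →ₗ[ℝ] polySpace d :=
  (η ^ 2 / 2) • (toPolySpace ∘ₗ polyLaplacian ∘ₗ
    (toPolySpace.exists_rightInverse_of_surjective
      (LinearMap.range_eq_top.2 toPolySpace_surjective)).choose)

lemma brownianGenerator_apply (η : ℝ) (p : MvPolynomial (Fin d) ℝ) (u : Vel d) :
    (brownianGenerator η (toPolySpace p) : C(Vel d, ℝ)) u =
      η ^ 2 / 2 * sphereLaplacian (polyFun p) u := by
  have hs := (toPolySpace.exists_rightInverse_of_surjective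
      (LinearMap.range_eq_top.2 (toPolySpace_surjective (d := d)))).choose_spec
  rw [brownianGenerator]
  generalize (toPolySpace.exists_rightInverse_of_surjective
      (LinearMap.range_eq_top.2 (toPolySpace_surjective (d := d)))).choose = s at hs
  have h1 : ∀ v : Vel d, polyFun (s (toPolySpace p)) v = polyFun p v := fun v => by
    have := congrArg (fun f => ((f (toPolySpace p) : polySpace d) : C(Vel d, ℝ)) v) hs
    simpa [coe_toPolySpace, polyC_apply] using this
  rw [← sphereLaplacian_congr h1, sphereLaplacian_polyFun]
  simp [coe_toPolySpace, polyC_apply]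

/-- The maximum principle for the difference of a smooth function and a polynomial. -/
lemma mul_sphereLaplacian_le (η : ℝ) {G G' : Conf d → ℝ} (hG : ContDiff ℝ 2 G)
    (hG' : ContDiff ℝ 2 G') {u : Vel d} (h : ∀ v : Vel d, G v - G' v ≤ G u - G' u) :
    η ^ 2 / 2 * sphereLaplacian G u ≤ η ^ 2 / 2 * sphereLaplacian G' u := by
  have := sphereLaplacian_nonpos (hG.sub hG') (u := u) h
  have h2 := sphereLaplacian_sub hG hG' u
  refine mul_le_mul_of_nonneg_left ?_ (by positivity)
  have h3 : sphereLaplacian (fun x => G x - G' x) u ≤ 0 := this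
  linarith

lemma isPregenerator_brownianGenerator (η : ℝ) :
    IsPregenerator (polySpace d).subtype (brownianGenerator η) where
  injective := Subtype.val_injective
  denseRange := by
    have : DenseRange (fun p : MvPolynomial (Fin d) ℝ => (polySpace d).subtype (toPolySpace p)) :=
      denseRange_polyC
    exact this.mono (Set.range_comp_subset_range _ _)
  exists_eq_one := ⟨toPolySpace 1, by simp [coe_toPolySpace]⟩
  locallyFinite f := by
    obtain ⟨p, rfl⟩ := toPolySpace_surjective f
    refine ⟨(MvPolynomial.restrictTotalDegree (Fin d) ℝ p.totalDegree).map toPolySpace,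
      ⟨p, (MvPolynomial.mem_restrictTotalDegree _ _ _).2 le_rfl, rfl⟩, inferInstance, ?_⟩
    rintro _ ⟨q, hq, rfl⟩
    refine ⟨(η ^ 2 / 2) • polyLaplacian q, ?_, ?_⟩
    · refine Submodule.smul_mem _ _ ((MvPolynomial.mem_restrictTotalDegree _ _ _).2 ?_)
      exact (totalDegree_polyLaplacian_le q).trans ((MvPolynomial.mem_restrictTotalDegree _ _ _).1 hq)
    · ext u
      rw [brownianGenerator_apply, sphereLaplacian_polyFun]
      simp [coe_toPolySpace, polyC_apply]
  apply_nonpos f u h := by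
    obtain ⟨p, rfl⟩ := toPolySpace_surjective f
    simp only [Submodule.subtype_apply, brownianGenerator_apply, coe_toPolySpace, polyC_apply] at h ⊢
    exact mul_nonpos_of_nonneg_of_nonpos (by positivity) (sphereLaplacian_nonpos (contDiff_polyFun p) h)

lemma IsSphereBrownian.isKernelSemigroup (hK : IsSphereBrownian η K) :
    IsKernelSemigroup (polySpace d).subtype (brownianGenerator η) K where
  markov := hK.markov
  zero := hK.zero
  add := hK.add
  generator f ε hε := by
    obtain ⟨p, rfl⟩ := toPolySpace_surjective f
    have h := Metric.tendstoUniformly_iff.1 (hK.generator (polyFun p) (contDiff_polyFun p)) ε hε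
    rw [eventually_nhdsWithin_iff] at h
    filter_upwards [h] with t ht u
    simp only [Submodule.subtype_apply, brownianGenerator_apply, coe_toPolySpace, polyC_apply]
    rcases eq_or_ne t 0 with rfl | h0
    · simp only [hK.zero, Kernel.id_apply]
      rw [integral_dirac' (fun v : Vel d => polyFun p v) _ ((contDiff_polyFun p (n := 0)).continuous.comp
        continuous_subtype_val).stronglyMeasurable]
      simp
    · have hpos : (0 : ℝ) < t := NNReal.coe_pos.2 (pos_iff_ne_zero.2 h0)
      have h1 := ht (pos_iff_ne_zero.2 h0) u
      rw [Real.dist_eq, abs_sub_comm] at h1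
      have h2 : (∫ y, polyFun p (y : Conf d) ∂(K t u)) - polyFun p u -
          t * (η ^ 2 / 2 * sphereLaplacian (polyFun p) u) =
          t * (((∫ y, polyFun p (y : Conf d) ∂(K t u)) - polyFun p u) / t -
            η ^ 2 / 2 * sphereLaplacian (polyFun p) u) := by
        field_simp
      rw [h2, abs_mul, abs_of_pos hpos, mul_comm]
      exact mul_le_mul_of_nonneg_right h1.le hpos.le

lemma IsSphereBrownian.eq {K' : ℝ≥0 → Kernel (Vel d) (Vel d)} (hK : IsSphereBrownian η K)
    (hK' : IsSphereBrownian η K') : K = K' :=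
  hK.isKernelSemigroup.eq (isPregenerator_brownianGenerator η) hK'.isKernelSemigroup

/-- The semigroup generated by `brownianGenerator η`, as kernels. -/
lemma exists_isSphereBrownian [Nonempty (Vel d)] (η : ℝ) :
    ∃ K : ℝ≥0 → Kernel (Vel d) (Vel d), IsSphereBrownian η K := by
  have hA := isPregenerator_brownianGenerator (d := d) η
  obtain ⟨T, hT⟩ := hA.exists_isSemigroup
  choose K hK hKT using fun t => exists_kernel_of_markovOperator (T t).toLinearMap
    (fun f hf => hT.nonneg hA t hf) (hT.one hA t)
  replace hKT : ∀ t (f : C(Vel d, ℝ)) u, ∫ v, f v ∂(K t u) = T t f u := hKT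
  refine ⟨K, hK, ?_, fun s t => ?_, fun G hG => ?_⟩
  · ext1 u
    rw [Kernel.id_apply]
    refine ext_of_forall_integral_continuousMap_eq fun f => ?_
    rw [hKT, hT.zero hA, integral_dirac' _ _ f.continuous.stronglyMeasurable]
  · ext1 u
    refine ext_of_forall_integral_continuousMap_eq fun f => ?_
    rw [Kernel.integral_comp (integrable_continuousMap _ _)]
    simp_rw [hKT]
    rw [add_comm, hT.add hA]
  · have hG2 : ContDiff ℝ 2 G := by exact_mod_cast contDiff_infty.1 hG 2
    let F : C(Vel d, ℝ) := ⟨fun u => G u, hG.continuous.comp continuous_subtype_val⟩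
    let g : C(Vel d, ℝ) := ⟨fun u => η ^ 2 / 2 * sphereLaplacian G u,
      continuous_const.mul (continuous_sphereLaplacian hG2)⟩
    have happ : ∀ ε > 0, ∃ w, ‖F - (polySpace d).subtype w‖ ≤ ε ∧
        ‖g - (polySpace d).subtype (brownianGenerator η w)‖ ≤ ε := fun ε hε => by
      refine hA.exists_approx (fun f u h => ?_) (fun f u h => ?_) hε
      · obtain ⟨p, rfl⟩ := toPolySpace_surjective f
        simp only [ContinuousMap.sub_apply, Submodule.subtype_apply, coe_toPolySpace,
          polyC_apply] at h
        rw [Submodule.subtype_apply, brownianGenerator_apply]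
        exact mul_sphereLaplacian_le η hG2 (contDiff_polyFun p) h
      · obtain ⟨p, rfl⟩ := toPolySpace_surjective f
        simp only [ContinuousMap.sub_apply, Submodule.subtype_apply, coe_toPolySpace,
          polyC_apply] at h
        rw [Submodule.subtype_apply, brownianGenerator_apply]
        refine mul_sphereLaplacian_le η (contDiff_polyFun p) hG2 fun v => ?_
        have : G u - polyFun p u ≤ G v - polyFun p v := h v
        linarith
    rw [Metric.tendstoUniformly_iff]
    intro ε hε
    rw [eventually_nhdsWithin_iff]
    filter_upwards [hT.eventually_norm_sub_sub_le hA happ (half_pos hε)] with t ht h0 u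
    have hpos : (0 : ℝ) < t := NNReal.coe_pos.2 h0
    have h1 : |T t F u - F u - t * g u| ≤ ε / 2 * t :=
      ((T t F - F - (t : ℝ) • g).norm_coe_le_norm u).trans ht
    have h2 : η ^ 2 / 2 * sphereLaplacian G u - ((∫ v, G (v : Conf d) ∂(K t u)) - G u) / t =
        -((T t F u - F u - t * g u) / t) := by
      rw [← hKT]
      simp only [F, g, ContinuousMap.coe_mk]
      field_simp
      ring
    rw [Real.dist_eq, h2, abs_neg, abs_div, abs_of_pos hpos, div_lt_iff₀ hpos]
    refine h1.trans_lt ?_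
    exact mul_lt_mul_of_pos_right (by linarith) hpos

/-- The surface measure is invariant under Brownian motion on the sphere. -/
lemma IsSphereBrownian.comp_toSphere (hK : IsSphereBrownian η K) (t : ℝ≥0) :
    K t ∘ₘ (volume : Measure (Conf d)).toSphere = (volume : Measure (Conf d)).toSphere := by
  refine hK.isKernelSemigroup.invariant (isPregenerator_brownianGenerator η) (fun f => ?_) t
  obtain ⟨p, rfl⟩ := toPolySpace_surjective f
  simp only [Submodule.subtype_apply, brownianGenerator_apply, sphereLaplacian_polyFun]
  rw [integral_const_mul, integral_polyLaplacian, mul_zero]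

lemma diffusionFlow_rhoInf (S : Conf d → ℝ) (c : ℝ)
    (hK : IsSphereBrownian η K) (s : ℝ≥0) :
    diffusionFlow K s (rhoInf S c) = rhoInf S c := by
  have := hK.markov s
  rw [diffusionFlow, rhoInf, ← Measure.prod_comp_right, hK.comp_toSphere]

end Brownian

end MCLMC

theorem theorem3 (d : ℕ) (hd : 2 ≤ d) (S : MCLMC.Conf d → ℝ) (hS : ContDiff ℝ 2 S)
    (c : ℝ) (hc : 0 < c) (η : ℝ) :
    (∃! φ : ℝ → MCLMC.Phase d → MCLMC.Phase d, MCLMC.IsFlow S φ) ∧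
    (∃! K : ℝ≥0 → Kernel (MCLMC.Vel d) (MCLMC.Vel d), MCLMC.IsSphereBrownian η K) ∧
    ∀ (φ : ℝ → MCLMC.Phase d → MCLMC.Phase d) (K : ℝ≥0 → Kernel (MCLMC.Vel d) (MCLMC.Vel d)),
      MCLMC.IsFlow S φ → MCLMC.IsSphereBrownian η K →
      ∀ ε : ℝ≥0,
        MCLMC.splittingStep (φ (ε : ℝ)) K ε (MCLMC.rhoInf S c) = MCLMC.rhoInf S c ∧
        ∀ Φ : MCLMC.Phase d → MCLMC.Phase d, Measurable Φ →
          (MCLMC.rhoInf S c).map Φ = MCLMC.rhoInf S c →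
          MCLMC.splittingStep Φ K ε (MCLMC.rhoInf S c) = MCLMC.rhoInf S c := by
  have hne : Nonempty (MCLMC.Vel d) :=
    ⟨⟨EuclideanSpace.single ⟨0, by omega⟩ 1, by simp⟩⟩
  refine ⟨MCLMC.existsUnique_isFlow hS, ?_, fun φ K hφ hK ε => ⟨?_, fun Φ _ hΦ => ?_⟩⟩
  · obtain ⟨K, hK⟩ := MCLMC.exists_isSphereBrownian (d := d) η
    exact ⟨K, hK, fun K' hK' => hK'.eq hK⟩
  · rw [MCLMC.splittingStep, hφ.map_rhoInf hd hS hc, MCLMC.diffusionFlow_rhoInf S c hK]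
  · rw [MCLMC.splittingStep, hΦ, MCLMC.diffusionFlow_rhoInf S c hK]
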